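/- **Setting.** Let $f$ be a continuous probability density on $\mathbb R$, let $f_\theta(x)=f(x-\theta)$, and let $\theta_0,\theta_1\in\mathbb R$ be such that $f_{\theta_0}-f_{\theta_1}$ takes both positive and negative values. Let $\alpha\ge 0$, let $d\ge 0$, and let $K\ge 1$ be an integer. Put $$Y_\alpha(x)=\frac{[f_{\theta_1}(x)]^\alpha-[f_{\theta_0}(x)]^\alpha}{\alpha}\quad(\alpha>0),\qquad Y_0(x)=\log\frac{f_{\theta_1}(x)}{f_{\theta_0}(x)}\in[-\infty,\infty]$$ (with $Y_0(x)=0$ where both densities vanish). For observations $X_{k,n}$ ($1\le k\le K$, $n\ge1$) let $W_{\alpha,k,0}=0$ and $W_{\alpha,k,n}=\max(W_{\alpha,k,n-1}+Y_\alpha(X_{k,n}),0)$, and let $$N_\alpha(b,d)=\inf\Big\{n\ge 1:\ \sum_{k=1}^K\max\{0,W_{\alpha,k,n}-d\}\ge b\Big\}.$$ Write $\mathbf E_h$ for the expectation when all $X_{k,n}$ are i.i.d. with density $h$. Let $b=b_\gamma$ be thresholds with $\mathbf E_{f_{\theta_0}}N_\alpha(b_\gamma,d)=(1+o(1))\gamma$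 as $\gamma\to\infty$. The false alarm breakdown point is $$\epsilon^*(N_\alpha)=\inf\Big\{\epsilon\in[0,1):\ \inf_{h\in\hbar_{0,\epsilon}}\log \mathbf E_h N_\alpha(b_\gamma,d)=o(\log\gamma)\ \text{ as }\gamma\to\infty\Big\},$$ where $\hbar_{0,\epsilon}=\{(1-\epsilon)f_{\theta_0}+\epsilon g:\ g \text{ any probability density on }\mathbb R\}$, and the infimum is taken to be $1$ if there is no such $\epsilon$. Let $$M(\alpha)=\operatorname*{ess\,sup}_x Y_\alpha(x)$$ and let $d_\alpha=d_\alpha(\theta_0,\theta_1)\in[0,\infty]$ be the density power divergence $$d_\alpha=\int\Big\{[f_{\theta_1}]^{1+\alpha}-\big(1+\tfrac1\alpha\big)f_{\theta_0}[f_{\theta_1}]^\alpha+\tfrac1\alpha[f_{\theta_0}]^{1+\alpha}\Big\}dx\quad(\alpha>0),\qquad d_0=\int f_{\theta_0}\log\frac{f_{\theta_0}}{f_{\theta_1}}\,dx .$$ **Theorem.** For every choice of such thresholds $b_\gamma$, $$\epsilon^*(N_\alpha)=\frac{d_\alpha}{d_\alpha+(1+\alpha)M(\alpha)}$$ whenever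 $d_\alpha$ and $M(\alpha)$ are not both infinite; the right-hand side is read as $0$ if $M(\alpha)=\infty$ and $d_\alpha<\infty$, and as $1$ if $d_\alpha=\infty$ and $M(\alpha)<\infty$. In particular $\epsilon^*(N_\alpha)=0$ if $M(\alpha)=\infty$ and $d_\alpha$ is finite. This applies to the classical CUSUM ($\alpha=0$) in the Gaussian case: if $f$ is the density of $N(0,\sigma^2)$ with $\sigma>0$, then $M(0)=\infty$, $d_0<\infty$ and $\epsilon^*(N_0)=0$. -/

import Mathlib

open MeasureTheory Filter Topology
open scoped ENNReal NNReal

noncomputable section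

/-- A probability density function on the real line (with respect to Lebesgue measure). -/
structure ProbDensity where
  toFun : ℝ → ℝ
  measurable' : Measurable toFun
  nonneg' : ∀ x, 0 ≤ toFun x
  lintegral_eq_one' : ∫⁻ x, ENNReal.ofReal (toFun x) = 1

namespace ProbDensity

instance : CoeFun ProbDensity (fun _ => ℝ → ℝ) := ⟨ProbDensity.toFun⟩

/-- The probability law with density `p`. -/
def law (p : ProbDensity) : Measure ℝ :=
  volume.withDensity (fun x => ENNReal.ofReal (p x))

instance (p : ProbDensity) : IsProbabilityMeasure p.law :=
  ⟨by rw [law, withDensity_apply _ MeasurableSet.univ, Measure.restrict_univ]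
      exact p.lintegral_eq_one'⟩

/-- The member `f_θ(x) = f(x - θ)` of the location family generated by `f`. -/
def shift (f : ProbDensity) (θ : ℝ) : ProbDensity where
  toFun x := f (x - θ)
  measurable' := f.measurable'.comp (measurable_id.sub_const θ)
  nonneg' x := f.nonneg' (x - θ)
  lintegral_eq_one' := by
    rw [lintegral_sub_right_eq_self (fun x => ENNReal.ofReal (f x)) θ]
    exact f.lintegral_eq_one'

end ProbDensity

/-- The increment of the local statistic as a function of the observed value `x`:
`([f₁(x)]^α - [f₀(x)]^α) / α` for `α > 0`, and the log-likelihood ratio `log (f₁(x) / f₀(x))` for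
`α = 0`.  In the latter case the value is `+∞` if `f₀(x) = 0 < f₁(x)`, it is `-∞` if
`f₁(x) = 0 < f₀(x)`, and it is `0` if both densities vanish at `x`; these are the limits of the
expression for `α > 0` as `α → 0`. -/
def lAlphaRatio (α : ℝ) (f₀ f₁ : ProbDensity) (x : ℝ) : EReal :=
  if α = 0 then
    if f₀ x = 0 ∧ f₁ x = 0 then 0
    else ENNReal.log (ENNReal.ofReal (f₁ x)) - ENNReal.log (ENNReal.ofReal (f₀ x))
  else (((f₁ x ^ α - f₀ x ^ α) / α : ℝ) : EReal)

/-- The `L_α`-CUSUM statistic `W_{α,n}` of one data stream; `x n` is the observation at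
time `n + 1`. -/
def lAlphaCusum (α : ℝ) (f₀ f₁ : ProbDensity) (x : ℕ → ℝ) : ℕ → EReal
  | 0 => 0
  | n + 1 => max (lAlphaCusum α f₀ f₁ x n + lAlphaRatio α f₀ f₁ (x n)) 0

/-- The scheme `N_α(b, d)`: the first time `n ≥ 1` at which `∑ₖ max {0, W_{α,k,n} - d} ≥ b`
(`⊤` if there is none).  The data are `ω (n, k)`, the observation of stream `k` at time `n + 1`. -/
def softThresholdScheme (α : ℝ) (f₀ f₁ : ProbDensity) (K : ℕ) (d b : ℝ)
    (ω : ℕ × Fin K → ℝ) : ℕ∞ :=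
  ⨅ (n : ℕ) (_ : 1 ≤ n ∧
    (b : EReal) ≤ ∑ k : Fin K, max 0 (lAlphaCusum α f₀ f₁ (fun i => ω (i, k)) n - (d : EReal))),
    (n : ℕ∞)

/-- The expected run length of `T` when the observations of all streams at all times are
independent and identically distributed with density `h`. -/
def expectedRunLength {K : ℕ} (h : ProbDensity) (T : (ℕ × Fin K → ℝ) → ℕ∞) : ℝ≥0∞ :=
  ∫⁻ ω, ((T ω : ℕ∞) : ℝ≥0∞) ∂(Measure.infinitePi (fun _ : ℕ × Fin K => h.law))

/-- The `ε`-contamination class `{(1 - ε) f₀ + ε g : g a probability density}`. -/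
def contaminationClass (f₀ : ProbDensity) (ε : ℝ) : Set ProbDensity :=
  {h | ∃ g : ProbDensity, ∀ x, h x = (1 - ε) * f₀ x + ε * g x}

/-- The thresholds `b = b_γ` satisfy the false alarm constraint under the idealized model:
`E_{f₀} T(b_γ) = (1 + o(1)) γ` as `γ → ∞`. -/
def SatisfiesFalseAlarmConstraint {K : ℕ} (f₀ : ProbDensity)
    (T : ℝ → (ℕ × Fin K → ℝ) → ℕ∞) (b : ℝ → ℝ) : Prop :=
  Tendsto (fun γ : ℝ => expectedRunLength f₀ (T (b γ)) / ENNReal.ofReal γ) atTop (𝓝 1)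

/-- Contamination of level `ε` breaks down the family:
`inf_{h} log E_h T(b_γ) = o(log γ)` as `γ → ∞`, the infimum being over the contamination class. -/
def BreaksDown {K : ℕ} (f₀ : ProbDensity) (T : ℝ → (ℕ × Fin K → ℝ) → ℕ∞) (b : ℝ → ℝ)
    (ε : ℝ) : Prop :=
  Tendsto (fun γ : ℝ =>
    (⨅ h ∈ contaminationClass f₀ ε, ENNReal.log (expectedRunLength h (T (b γ)))) /
      ((Real.log γ : ℝ) : EReal)) atTop (𝓝 0)

/-- The false alarm breakdown point: the infimum of the `ε ∈ [0, 1)` that break down the family,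
taken in `[0, 1]`, so that it is `1` if there is no such `ε`. -/
def falseAlarmBreakdownPoint {K : ℕ} (f₀ : ProbDensity) (T : ℝ → (ℕ × Fin K → ℝ) → ℕ∞)
    (b : ℝ → ℝ) : ℝ :=
  sInf (insert 1 {ε : ℝ | 0 ≤ ε ∧ ε < 1 ∧ BreaksDown f₀ T b ε})

/-- The intrinsic bound `M(α)`, the essential supremum of the increment. -/
def intrinsicBound (α : ℝ) (f₀ f₁ : ProbDensity) : EReal :=
  essSup (lAlphaRatio α f₀ f₁) volume

/-- The density power divergence `d_α`, with values in `[0, ∞]`.  For `α > 0` the integrand is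
nonnegative at every point (weighted arithmetic-geometric mean inequality), so `ENNReal.ofReal`
does not change it.  For `α = 0` it is the Kullback-Leibler divergence
`∫ f₀ log (f₀ / f₁)`. -/
def densityPowerDivergence (α : ℝ) (f₀ f₁ : ProbDensity) : ℝ≥0∞ :=
  if α = 0 then InformationTheory.klDiv f₀.law f₁.law
  else ∫⁻ x, ENNReal.ofReal
    (f₁ x ^ (1 + α) - (1 + 1 / α) * f₀ x * f₁ x ^ α + 1 / α * f₀ x ^ (1 + α))

end

/-!
Write `Y` for the increment, `m` for its essential supremum and `W` for a local statistic. Under a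
contaminated density `(1 - ε) f₀ + ε g` the mean of `Y` is `(1 - ε) E₀ Y + ε E_g Y`. Its supremum
over `g` is `(1 - ε) E₀ Y + ε m`. The scheme breaks down when this worst-case drift is positive and
does not when it is negative.

The value of `E₀ Y` comes from `lintegral_incrementGap`: `(1 + α) E₀ (m - Y) = d_α + (1 + α) m`, an
identity in `[0, ∞]`. For `α = 0` it is the definition of the Kullback-Leibler divergence. For
`α > 0` it says that `∫ f₁ ^ (1 + α)` and `∫ f₀ ^ (1 + α)` cancel. In a location family these
integrals are equal, but they may be infinite, so the cancellation is done on translation-invariant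
sets on which `f₀` is bounded (`lintegral_incrementGap_pos`). The critical level is the zero
`d_α / (d_α + (1 + α) m)` of the worst-case drift.

* Below the critical level, truncating `m - Y` gives one exponent `l > 0` with `E_h e^{lY} ≤ 1` for
  every `h` in the class (`exists_exp_moment_le_one`). Then `E_h e^{l W_n} ≤ n + 1`, and Markov's
  inequality makes all expected run lengths at least exponential in the threshold
  (`exists_exp_le_expectedRunLength`).
* Above it, some `g` concentrated where `Y` is close to `m` makes the drift positive, and Wald's
  argument bounds the expected run length by a linear function of the threshold
  (`expectedRunLength_le_of_drift`).
* If `m = ∞`, observations with `Y` above the threshold end the run at once, so that a proportion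
  `ε > 0` of them brings the expected run length down to `1 / ε`
  (`breaksDown_of_intrinsicBound_eq_top`).

The thresholds are comparable to `log γ`. The upper bound on `b_γ` is the exponential estimate at
`ε = 0`. The lower bound holds because a block of `O(b)` large increments ends the run
(`exists_expectedRunLength_le_exp`); large increments have positive probability under `f₀`, since
otherwise the expected run length would be `1` or `∞` and could not be equivalent to `γ`.
-/

/-! ### Measurability of the increment and of the local statistic -/

lemma measurable_lAlphaRatio (α : ℝ) (f₀ f₁ : ProbDensity) : Measurable (lAlphaRatio α f₀ f₁) := by
  have h₀ := f₀.measurable'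
  have h₁ := f₁.measurable'
  unfold lAlphaRatio
  by_cases hα : α = 0
  · simp only [hα, if_true]
    refine Measurable.ite ?_ measurable_const ?_
    · exact (h₀ (measurableSet_singleton 0)).inter (h₁ (measurableSet_singleton 0))
    · simp only [sub_eq_add_neg]
      exact (h₁.ennreal_ofReal.ennreal_log).add
        (continuous_neg.measurable.comp h₀.ennreal_ofReal.ennreal_log)
  · simp only [hα, if_false]
    exact (((h₁.pow_const α).sub (h₀.pow_const α)).div_const α).coe_real_ereal

/-- The gap `m - Y` between a bound `m` for the increment and the increment `Y`, as an extended
nonnegative number; it is `0` where the bound fails. -/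
noncomputable def incrementGap (α : ℝ) (f₀ f₁ : ProbDensity) (m t : ℝ) : ℝ≥0∞ :=
  ((m : EReal) - lAlphaRatio α f₀ f₁ t).toENNReal

lemma measurable_incrementGap (α : ℝ) (f₀ f₁ : ProbDensity) (m : ℝ) :
    Measurable (incrementGap α f₀ f₁ m) := by
  refine Measurable.ereal_toENNReal ?_
  simp only [sub_eq_add_neg]
  exact measurable_const.add (continuous_neg.measurable.comp (measurable_lAlphaRatio α f₀ f₁))

lemma measurable_lAlphaCusum (α : ℝ) (f₀ f₁ : ProbDensity) (n : ℕ) :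
    Measurable fun x : ℕ → ℝ => lAlphaCusum α f₀ f₁ x n := by
  induction n with
  | zero => exact measurable_const
  | succ n ih =>
    exact (ih.add ((measurable_lAlphaRatio α f₀ f₁).comp (measurable_pi_apply n))).max
      measurable_const

lemma lAlphaCusum_nonneg (α : ℝ) (f₀ f₁ : ProbDensity) (x : ℕ → ℝ) (n : ℕ) :
    0 ≤ lAlphaCusum α f₀ f₁ x n := by
  cases n with
  | zero => exact le_rfl
  | succ n => exact le_max_right _ _

lemma lAlphaCusum_add_le (α : ℝ) (f₀ f₁ : ProbDensity) (x : ℕ → ℝ) (n : ℕ) :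
    lAlphaCusum α f₀ f₁ x n + lAlphaRatio α f₀ f₁ (x n) ≤ lAlphaCusum α f₀ f₁ x (n + 1) :=
  le_max_left _ _

lemma dependsOn_lAlphaCusum (α : ℝ) (f₀ f₁ : ProbDensity) (n : ℕ) :
    DependsOn (fun x : ℕ → ℝ => lAlphaCusum α f₀ f₁ x n) (Finset.range n : Set ℕ) := by
  intro x y hxy
  simp only [Finset.coe_range, Set.mem_Iio] at hxy
  induction n with
  | zero => rfl
  | succ n ih =>
    have := ih fun i hi => hxy i (by omega)
    simp only [lAlphaCusum] at this ⊢
    rw [this, hxy n (by omega)]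

/-! ### Independent observations -/

/-- The law of one data stream: an i.i.d. sequence with density `h`. -/
noncomputable abbrev streamLaw (h : ProbDensity) : Measure (ℕ → ℝ) := Measure.infinitePi fun _ : ℕ => h.law

lemma map_stream {K : ℕ} (h : ProbDensity) (k : Fin K) :
    (Measure.infinitePi fun _ : ℕ × Fin K => h.law).map (fun ω i => ω (i, k)) = streamLaw h := by
  have h1 := ProbabilityTheory.iIndepFun_infinitePi (P := fun _ : ℕ × Fin K => h.law)
    (X := fun _ x => x) fun _ => measurable_id
  have hinj : Function.Injective fun i : ℕ => (i, k) := fun i j hij => (Prod.mk.inj hij).1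
  have h2 := (h1.precomp hinj).map_fun_eq_infinitePi_map fun _ => measurable_pi_apply _
  rw [h2, streamLaw]
  congr 1
  funext i
  exact Measure.infinitePi_map_eval (fun _ : ℕ × Fin K => h.law) (i, k)

lemma measurable_stream {K : ℕ} (k : Fin K) :
    Measurable fun (ω : ℕ × Fin K → ℝ) (i : ℕ) => ω (i, k) :=
  measurable_pi_lambda _ fun _ => measurable_pi_apply _

/-- A function of an infinite sequence that depends on finitely many coordinates factors
measurably through them. -/
lemma exists_measurable_factor {S : Finset ℕ} {F : (ℕ → ℝ) → ℝ≥0∞} (hF : Measurable F)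
    (hd : DependsOn F (S : Set ℕ)) :
    ∃ F' : (S → ℝ) → ℝ≥0∞, Measurable F' ∧ F = fun x => F' fun i => x i := by
  refine ⟨fun y => F fun i => if hi : i ∈ S then y ⟨i, hi⟩ else 0, hF.comp ?_, ?_⟩
  · refine measurable_pi_lambda _ fun i => ?_
    by_cases hi : i ∈ S
    · simp only [hi, dite_true]
      exact measurable_pi_apply _
    · simp only [hi, dite_false]
      exact measurable_const
  · funext x
    refine hd fun i hi => ?_
    simp [Finset.mem_coe.1 hi]

lemma lintegral_mul_of_dependsOn (h : ProbDensity) {S T : Finset ℕ} (hST : Disjoint S T)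
    {F G : (ℕ → ℝ) → ℝ≥0∞} (hF : Measurable F) (hG : Measurable G)
    (hFd : DependsOn F (S : Set ℕ)) (hGd : DependsOn G (T : Set ℕ)) :
    ∫⁻ x, F x * G x ∂(streamLaw h) = (∫⁻ x, F x ∂(streamLaw h)) * ∫⁻ x, G x ∂(streamLaw h) := by
  obtain ⟨F', hF', rfl⟩ := exists_measurable_factor hF hFd
  obtain ⟨G', hG', rfl⟩ := exists_measurable_factor hG hGd
  have h1 := ProbabilityTheory.iIndepFun_infinitePi (P := fun _ : ℕ => h.law)
    (X := fun _ x => x) fun _ => measurable_id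
  have h2 := (h1.indepFun_finset S T hST fun i => measurable_pi_apply i).comp hF' hG'
  exact ProbabilityTheory.lintegral_mul_eq_lintegral_mul_lintegral_of_indepFun hF hG h2

lemma lintegral_eval (h : ProbDensity) (n : ℕ) {G : ℝ → ℝ≥0∞} (hG : Measurable G) :
    ∫⁻ x, G (x n) ∂(streamLaw h) = ∫⁻ t, G t ∂h.law := by
  rw [← Measure.infinitePi_map_eval (fun _ : ℕ => h.law) n,
    lintegral_map hG (measurable_pi_apply n)]

/-- An observation is independent of the past of its stream. -/
lemma lintegral_mul_eval (h : ProbDensity) (n : ℕ) {F : (ℕ → ℝ) → ℝ≥0∞} {G : ℝ → ℝ≥0∞}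
    (hF : Measurable F) (hG : Measurable G) (hFd : DependsOn F (Finset.range n : Set ℕ)) :
    ∫⁻ x, F x * G (x n) ∂(streamLaw h) = (∫⁻ x, F x ∂(streamLaw h)) * ∫⁻ t, G t ∂h.law := by
  rw [← lintegral_eval h n hG]
  refine lintegral_mul_of_dependsOn h (T := {n}) (by simp) hF
    (hG.comp (measurable_pi_apply n)) hFd ?_
  intro x y hxy
  simp [hxy n (by simp)]

/-! ### The run length is dominated by the passage time of one stream -/

/-- The event that one local statistic stays below the level `c` at the times `1, …, n`. -/
def staysBelow (α : ℝ) (f₀ f₁ : ProbDensity) (c : ℝ) (n : ℕ) : Set (ℕ → ℝ) :=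
  {x | ∀ j < n, lAlphaCusum α f₀ f₁ x (j + 1) < c}

lemma measurableSet_staysBelow (α : ℝ) (f₀ f₁ : ProbDensity) (c : ℝ) (n : ℕ) :
    MeasurableSet (staysBelow α f₀ f₁ c n) := by
  simp only [staysBelow, Set.ofPred_forall]
  exact MeasurableSet.iInter fun j => MeasurableSet.iInter fun _ =>
    measurableSet_lt (measurable_lAlphaCusum α f₀ f₁ (j + 1)) measurable_const

lemma staysBelow_anti (α : ℝ) (f₀ f₁ : ProbDensity) (c : ℝ) :
    Antitone (staysBelow α f₀ f₁ c) :=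
  fun _ _ hmn _ hx j hj => hx j (hj.trans_le hmn)

lemma mem_staysBelow_congr (α : ℝ) (f₀ f₁ : ProbDensity) (c : ℝ) (n : ℕ) {x y : ℕ → ℝ}
    (hxy : ∀ i < n, x i = y i) : x ∈ staysBelow α f₀ f₁ c n ↔ y ∈ staysBelow α f₀ f₁ c n := by
  refine forall₂_congr fun j hj => ?_
  have h : lAlphaCusum α f₀ f₁ x (j + 1) = lAlphaCusum α f₀ f₁ y (j + 1) :=
    dependsOn_lAlphaCusum α f₀ f₁ (j + 1) fun i hi => hxy i (by simp at hi; omega)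
  rw [h]

lemma dependsOn_indicator_staysBelow (α : ℝ) (f₀ f₁ : ProbDensity) (c : ℝ) (n : ℕ) :
    DependsOn ((staysBelow α f₀ f₁ c n).indicator (1 : (ℕ → ℝ) → ℝ≥0∞))
      (Finset.range n : Set ℕ) := by
  intro x y hxy
  have := mem_staysBelow_congr α f₀ f₁ c n (x := x) (y := y) (by simpa using hxy)
  classical
  simp only [Set.indicator_apply, this, Pi.one_apply]

lemma softThresholdScheme_le {α : ℝ} {f₀ f₁ : ProbDensity} {K : ℕ} {d b : ℝ}
    {ω : ℕ × Fin K → ℝ} {n : ℕ} (k : Fin K) (hn : 1 ≤ n)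
    (h : ((b + d : ℝ) : EReal) ≤ lAlphaCusum α f₀ f₁ (fun i => ω (i, k)) n) :
    softThresholdScheme α f₀ f₁ K d b ω ≤ n := by
  refine iInf₂_le n ⟨hn, ?_⟩
  have h1 : (b : EReal) ≤ max 0 (lAlphaCusum α f₀ f₁ (fun i => ω (i, k)) n - (d : EReal)) := by
    refine le_max_of_le_right ?_
    rw [EReal.le_sub_iff_add_le (by simp) (by simp)]
    exact_mod_cast h
  exact h1.trans (Finset.single_le_sum
    (f := fun k => max 0 (lAlphaCusum α f₀ f₁ (fun i => ω (i, k)) n - (d : EReal)))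
    (fun i _ => le_max_left _ _) (Finset.mem_univ k))

lemma softThresholdScheme_le_tsum (α : ℝ) (f₀ f₁ : ProbDensity) {K : ℕ} (d b : ℝ) (k : Fin K)
    (ω : ℕ × Fin K → ℝ) :
    ((softThresholdScheme α f₀ f₁ K d b ω : ℕ∞) : ℝ≥0∞) ≤
      ∑' n, (staysBelow α f₀ f₁ (b + d) n).indicator (1 : (ℕ → ℝ) → ℝ≥0∞)
        (fun i => ω (i, k)) := by
  classical
  set x : ℕ → ℝ := fun i => ω (i, k) with hx
  by_cases hex : ∃ j, ¬ lAlphaCusum α f₀ f₁ x (j + 1) < ((b + d : ℝ) : EReal)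
  · have h1 := softThresholdScheme_le (ω := ω) k (Nat.succ_le_succ (Nat.zero_le _))
      (not_lt.1 (Nat.find_spec hex))
    have h2 : ((softThresholdScheme α f₀ f₁ K d b ω : ℕ∞) : ℝ≥0∞) ≤
        ((Nat.find hex + 1 : ℕ) : ℝ≥0∞) := by exact_mod_cast h1
    refine h2.trans ?_
    have h3 : ∀ n ∈ Finset.range (Nat.find hex + 1),
        (staysBelow α f₀ f₁ (b + d) n).indicator (1 : (ℕ → ℝ) → ℝ≥0∞) x = 1 := by
      intro n hn
      have hmem : x ∈ staysBelow α f₀ f₁ (b + d) n := fun j hj =>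
        not_not.1 (Nat.find_min hex (by rw [Finset.mem_range] at hn; omega))
      exact Set.indicator_of_mem hmem _
    calc ((Nat.find hex + 1 : ℕ) : ℝ≥0∞)
        = ∑ n ∈ Finset.range (Nat.find hex + 1),
          (staysBelow α f₀ f₁ (b + d) n).indicator (1 : (ℕ → ℝ) → ℝ≥0∞) x := by
          rw [Finset.sum_congr rfl h3]; simp
      _ ≤ _ := ENNReal.sum_le_tsum _
  · push Not at hex
    have h3 : ∀ n, (staysBelow α f₀ f₁ (b + d) n).indicator (1 : (ℕ → ℝ) → ℝ≥0∞) x = 1 :=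
      fun n => Set.indicator_of_mem (show x ∈ staysBelow α f₀ f₁ (b + d) n from fun j _ => hex j) _
    simp only [h3]
    rw [ENNReal.tsum_const_eq_top_of_ne_zero one_ne_zero]
    exact le_top

lemma expectedRunLength_le_tsum (α : ℝ) (f₀ f₁ : ProbDensity) {K : ℕ} (hK : 1 ≤ K) (d b : ℝ)
    (h : ProbDensity) :
    expectedRunLength h (softThresholdScheme α f₀ f₁ K d b) ≤
      ∑' n, streamLaw h (staysBelow α f₀ f₁ (b + d) n) := by
  have hm : ∀ n, Measurable ((staysBelow α f₀ f₁ (b + d) n).indicator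
      (1 : (ℕ → ℝ) → ℝ≥0∞)) := fun n =>
    measurable_one.indicator (measurableSet_staysBelow α f₀ f₁ _ n)
  have k : Fin K := ⟨0, hK⟩
  calc expectedRunLength h (softThresholdScheme α f₀ f₁ K d b)
      ≤ ∫⁻ ω, ∑' n, (staysBelow α f₀ f₁ (b + d) n).indicator (1 : (ℕ → ℝ) → ℝ≥0∞)
        (fun i => ω (i, k)) ∂(Measure.infinitePi fun _ : ℕ × Fin K => h.law) :=
        lintegral_mono fun ω => softThresholdScheme_le_tsum α f₀ f₁ d b k ω
    _ = ∫⁻ x, ∑' n, (staysBelow α f₀ f₁ (b + d) n).indicator (1 : (ℕ → ℝ) → ℝ≥0∞) x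
        ∂(streamLaw h) := by
        rw [← map_stream h k, lintegral_map (Measurable.tsum hm) (measurable_stream k)]
    _ = ∑' n, streamLaw h (staysBelow α f₀ f₁ (b + d) n) := by
        rw [lintegral_tsum fun n => (hm n).aemeasurable]
        exact tsum_congr fun n => lintegral_indicator_one (measurableSet_staysBelow α f₀ f₁ _ n)

lemma one_le_expectedRunLength (α : ℝ) (f₀ f₁ : ProbDensity) (K : ℕ) (d b : ℝ)
    (h : ProbDensity) : 1 ≤ expectedRunLength h (softThresholdScheme α f₀ f₁ K d b) := by
  have h1 : ∀ ω, (1 : ℝ≥0∞) ≤ ((softThresholdScheme α f₀ f₁ K d b ω : ℕ∞) : ℝ≥0∞) := by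
    intro ω
    have : (1 : ℕ∞) ≤ softThresholdScheme α f₀ f₁ K d b ω :=
      le_iInf₂ fun n hn => by exact_mod_cast hn.1
    exact_mod_cast this
  calc (1 : ℝ≥0∞) = ∫⁻ _, 1 ∂(Measure.infinitePi fun _ : ℕ × Fin K => h.law) := by simp
    _ ≤ _ := lintegral_mono h1

lemma expectedRunLength_mono (α : ℝ) (f₀ f₁ : ProbDensity) (K : ℕ) (d : ℝ) (h : ProbDensity) :
    Monotone fun b => expectedRunLength h (softThresholdScheme α f₀ f₁ K d b) := by
  intro b b' hbb
  refine lintegral_mono fun ω => ?_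
  have : softThresholdScheme α f₀ f₁ K d b ω ≤ softThresholdScheme α f₀ f₁ K d b' ω :=
    le_iInf₂ fun n hn => iInf₂_le n ⟨hn.1, (EReal.coe_le_coe_iff.2 hbb).trans hn.2⟩
  exact ENat.toENNReal_le.2 this

/-! ### Upper bounds on the expected run length -/

lemma lAlphaCusum_ge_of_block {α : ℝ} {f₀ f₁ : ProbDensity} {c : ℝ} {x : ℕ → ℝ} {n r : ℕ}
    (hx : ∀ i, n ≤ i → i < n + r → (c : EReal) ≤ lAlphaRatio α f₀ f₁ (x i)) :
    ((r * c : ℝ) : EReal) ≤ lAlphaCusum α f₀ f₁ x (n + r) := by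
  induction r with
  | zero => simpa using lAlphaCusum_nonneg α f₀ f₁ x n
  | succ r ih =>
    have h1 := ih fun i hi hi' => hx i hi (by omega)
    have h2 := hx (n + r) (by omega) (by omega)
    refine le_trans ?_ ((add_le_add h1 h2).trans (lAlphaCusum_add_le α f₀ f₁ x (n + r)))
    rw [← EReal.coe_add]
    refine EReal.coe_le_coe_iff.2 (le_of_eq ?_)
    push_cast
    ring

/-- If `r` successive increments that are at least `c` carry a statistic over the threshold, and
`q` is the probability of one such increment, then the expected run length is at most `r / q ^ r`:
every block of `r` observations ends the run with probability at least `q ^ r`, independently of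
the past. -/
lemma pow_mul_expectedRunLength_le {α : ℝ} {f₀ f₁ : ProbDensity} {K : ℕ} (hK : 1 ≤ K)
    {d b c : ℝ} {r : ℕ} (hr : 1 ≤ r) (hc : b + d ≤ r * c) (h : ProbDensity) :
    h.law {t | (c : EReal) ≤ lAlphaRatio α f₀ f₁ t} ^ r *
      expectedRunLength h (softThresholdScheme α f₀ f₁ K d b) ≤ r := by
  set s : Set ℝ := {t | (c : EReal) ≤ lAlphaRatio α f₀ f₁ t} with hs
  have hsm : MeasurableSet s := measurableSet_le measurable_const (measurable_lAlphaRatio α f₀ f₁)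
  set A := staysBelow α f₀ f₁ (b + d) with hA
  have hAm := measurableSet_staysBelow α f₀ f₁ (b + d)
  set p : ℕ → ℝ≥0∞ := fun n => streamLaw h (A n) with hp
  have hp1 : ∀ n, p n ≤ 1 := fun n => prob_le_one
  have hstep : ∀ n, h.law s ^ r * p n + p (n + r) ≤ p n := by
    intro n
    set G : Set (ℕ → ℝ) := ((Finset.Ico n (n + r) : Finset ℕ) : Set ℕ).pi fun _ => s with hG
    have hGm : MeasurableSet G :=
      MeasurableSet.pi (Set.to_countable _) fun _ _ => hsm
    have hGp : streamLaw h G = h.law s ^ r := by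
      rw [hG, streamLaw, Measure.infinitePi_pi _ fun _ _ => hsm]
      simp
    have hGd : DependsOn (G.indicator (1 : (ℕ → ℝ) → ℝ≥0∞))
        ((Finset.Ico n (n + r) : Finset ℕ) : Set ℕ) := by
      intro x y hxy
      have : x ∈ G ↔ y ∈ G := forall₂_congr fun i hi => by rw [hxy i hi]
      classical
      simp only [Set.indicator_apply, this, Pi.one_apply]
    have hind : p n * h.law s ^ r = streamLaw h (A n ∩ G) := by
      have h1 := lintegral_mul_of_dependsOn h (S := Finset.range n) (T := Finset.Ico n (n + r))
        (by rw [Finset.disjoint_left]; intro i hi hi'; simp at hi hi'; omega)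
        (measurable_one.indicator (hAm n)) (measurable_one.indicator hGm)
        (dependsOn_indicator_staysBelow α f₀ f₁ (b + d) n) hGd
      rw [lintegral_indicator_one (hAm n), lintegral_indicator_one hGm, hGp] at h1
      rw [hp, ← h1, ← lintegral_indicator_one ((hAm n).inter hGm)]
      refine lintegral_congr fun x => ?_
      rw [Set.inter_indicator_one, Pi.mul_apply]
    have hdisj : Disjoint (A n ∩ G) (A (n + r)) := by
      rw [Set.disjoint_left]
      rintro x ⟨-, hxG⟩ hxA
      have h1 : ((r * c : ℝ) : EReal) ≤ lAlphaCusum α f₀ f₁ x (n + r) :=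
        lAlphaCusum_ge_of_block fun i hi hi' => hxG i (by simp; omega)
      have h2 := hxA (n + r - 1) (by omega)
      rw [show n + r - 1 + 1 = n + r by omega] at h2
      exact absurd (h1.trans_lt h2) (not_lt.2 (EReal.coe_le_coe_iff.2 hc))
    rw [mul_comm, hind, hp, ← measure_union hdisj (hAm _)]
    exact measure_mono (Set.union_subset Set.inter_subset_left
      (staysBelow_anti α f₀ f₁ (b + d) (Nat.le_add_right n r)))
  refine (mul_le_mul_right (expectedRunLength_le_tsum α f₀ f₁ hK d b h) _).trans ?_
  rw [← ENNReal.tsum_mul_left]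
  refine ENNReal.tsum_le_of_sum_range_le fun m => ?_
  have h1 : ∑ n ∈ Finset.range m, h.law s ^ r * p n + ∑ n ∈ Finset.range m, p (r + n) ≤
      r + ∑ n ∈ Finset.range m, p (r + n) := by
    calc _ = ∑ n ∈ Finset.range m, (h.law s ^ r * p n + p (n + r)) := by
          rw [Finset.sum_add_distrib]; simp only [add_comm]
      _ ≤ ∑ n ∈ Finset.range m, p n := Finset.sum_le_sum fun n _ => hstep n
      _ ≤ ∑ n ∈ Finset.range (r + m), p n :=
          Finset.sum_le_sum_of_subset (Finset.range_mono (Nat.le_add_left m r))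
      _ = ∑ n ∈ Finset.range r, p n + ∑ n ∈ Finset.range m, p (r + n) :=
          Finset.sum_range_add _ _ _
      _ ≤ _ := by
          gcongr
          refine (Finset.sum_le_sum fun n _ => hp1 n).trans ?_
          simp
  have hfin : ∑ n ∈ Finset.range m, p (r + n) ≠ ⊤ :=
    ENNReal.sum_ne_top.2 fun n _ => ne_top_of_le_ne_top ENNReal.one_ne_top (hp1 _)
  exact (ENNReal.add_le_add_iff_right hfin).1 h1

/-- The pathwise inequality behind Wald's bound.  If no increment exceeds `m`, each step before the
passage over `c` moves the statistic by at least `m - (m - Y)`, and the overshoot is at most `m`. -/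
lemma mul_sum_indicator_staysBelow_le {α : ℝ} {f₀ f₁ : ProbDensity} {c m : ℝ} (hc : 0 < c)
    (hm : 0 < m) {x : ℕ → ℝ} (hx : ∀ i, lAlphaRatio α f₀ f₁ (x i) ≤ m) (n : ℕ) :
    ENNReal.ofReal m * ∑ i ∈ Finset.range n,
        (staysBelow α f₀ f₁ c i).indicator (1 : (ℕ → ℝ) → ℝ≥0∞) x ≤
      ∑ i ∈ Finset.range n, (staysBelow α f₀ f₁ c i).indicator (1 : (ℕ → ℝ) → ℝ≥0∞) x *
        incrementGap α f₀ f₁ m (x i) + ENNReal.ofReal (c + m) := by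
  classical
  set A := staysBelow α f₀ f₁ c with hA
  set w : ℕ → EReal := lAlphaCusum α f₀ f₁ x with hw
  have hwA : ∀ n, x ∈ A n → w n < c := by
    intro n hn
    cases n with
    | zero => exact EReal.coe_lt_coe_iff.2 hc
    | succ n => exact hn n (Nat.lt_succ_self n)
  have key : ∀ n, ENNReal.ofReal m * ∑ i ∈ Finset.range n,
        (A i).indicator (1 : (ℕ → ℝ) → ℝ≥0∞) x ≤
      ∑ i ∈ Finset.range n, (A i).indicator (1 : (ℕ → ℝ) → ℝ≥0∞) x *
        incrementGap α f₀ f₁ m (x i) +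
      (if x ∈ A n then (w n).toENNReal else ENNReal.ofReal (c + m)) := by
    intro n
    induction n with
    | zero => simp
    | succ n ih =>
      rw [Finset.sum_range_succ, Finset.sum_range_succ]
      by_cases hn : x ∈ A n
      · rw [if_pos hn] at ih
        rw [Set.indicator_of_mem hn, Pi.one_apply, one_mul, mul_add, mul_one, add_assoc]
        refine (add_le_add_left ih _).trans ?_
        rw [add_assoc]
        refine add_le_add_right ?_ _
        have hw0 : 0 ≤ w n := lAlphaCusum_nonneg α f₀ f₁ x n
        have hwn := hwA n hn
        have hsucc : w (n + 1) = max (w n + lAlphaRatio α f₀ f₁ (x n)) 0 := rfl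
        have hxn := hx n
        lift w n to ℝ using ⟨(hwn.trans (EReal.coe_lt_top c)).ne,
          (EReal.bot_lt_zero.trans_le hw0).ne'⟩ with u hu
        rw [incrementGap]
        generalize lAlphaRatio α f₀ f₁ (x n) = v at hxn hsucc ⊢
        induction v with
        | bot => simp
        | top => simp at hxn
        | coe y =>
          have hxn' : y ≤ m := EReal.coe_le_coe_iff.1 hxn
          have hu0 : 0 ≤ u := EReal.coe_le_coe_iff.1 hw0
          have huc : u < c := EReal.coe_lt_coe_iff.1 hwn
          have hsucc' : w (n + 1) = ((max (u + y) 0 : ℝ) : EReal) := by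
            rw [hsucc, ← EReal.coe_add, ← EReal.coe_zero,
              (EReal.coe_strictMono.monotone).map_max]
          have hdiff : ((m : EReal) - (y : EReal)).toENNReal = ENNReal.ofReal (m - y) := by
            rw [← EReal.coe_sub, EReal.real_coe_toENNReal]
          have hle : ENNReal.ofReal (max (u + y) 0) ≤
              (if x ∈ A (n + 1) then (w (n + 1)).toENNReal else ENNReal.ofReal (c + m)) := by
            split_ifs
            · rw [hsucc', EReal.real_coe_toENNReal]
            · exact ENNReal.ofReal_le_ofReal (max_le (by linarith) (by linarith))
          refine le_trans ?_ (add_le_add_right hle _)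
          rw [hdiff, EReal.real_coe_toENNReal, ← ENNReal.ofReal_add hu0 hm.le,
            ← ENNReal.ofReal_add (by linarith) (le_max_right _ _)]
          refine ENNReal.ofReal_le_ofReal ?_
          have := le_max_left (u + y) 0
          linarith
      · have hn' : x ∉ A (n + 1) := fun h => hn (staysBelow_anti α f₀ f₁ c (Nat.le_succ n) h)
        rw [if_neg hn] at ih
        rw [Set.indicator_of_notMem hn, if_neg hn', zero_mul, add_zero, add_zero]
        exact ih
  refine (key n).trans (add_le_add_right ?_ _)
  split_ifs with hn
  · refine (EReal.toENNReal_le_toENNReal (hwA n hn).le).trans ?_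
    rw [EReal.real_coe_toENNReal]
    exact ENNReal.ofReal_le_ofReal (by linarith)
  · exact le_rfl

/-- Wald's bound: if the increment is at most `m` and has mean at least `m - z > 0`, the expected
run length grows at most linearly in the threshold.  Phrased through `m - Y ≥ 0`, it needs no
integrability of the increment. -/
lemma expectedRunLength_le_of_drift {α : ℝ} {f₀ f₁ : ProbDensity} {K : ℕ} (hK : 1 ≤ K)
    {d b m z : ℝ} (hc : 0 < b + d) (hm : 0 < m) (hz : 0 ≤ z) (hzm : z < m) (h : ProbDensity)
    (hY : ∀ᵐ t ∂h.law, lAlphaRatio α f₀ f₁ t ≤ m)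
    (hZ : ∫⁻ t, incrementGap α f₀ f₁ m t ∂h.law ≤ ENNReal.ofReal z) :
    expectedRunLength h (softThresholdScheme α f₀ f₁ K d b) ≤
      ENNReal.ofReal ((b + d + m) / (m - z)) := by
  set A := staysBelow α f₀ f₁ (b + d) with hA
  have hAm := measurableSet_staysBelow α f₀ f₁ (b + d)
  have hAm' : ∀ i, Measurable ((A i).indicator (1 : (ℕ → ℝ) → ℝ≥0∞)) := fun i =>
    measurable_one.indicator (hAm i)
  set Z : ℝ → ℝ≥0∞ := incrementGap α f₀ f₁ m with hZdef
  have hZm : Measurable Z := measurable_incrementGap α f₀ f₁ m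
  have hZm' : ∀ i, Measurable fun x : ℕ → ℝ => Z (x i) := fun i =>
    hZm.comp (measurable_pi_apply i)
  refine (expectedRunLength_le_tsum α f₀ f₁ hK d b h).trans
    (ENNReal.tsum_le_of_sum_range_le fun n => ?_)
  set p : ℕ → ℝ≥0∞ := fun n => streamLaw h (A n) with hp
  have hfin : ∑ i ∈ Finset.range n, p i ≠ ⊤ :=
    ENNReal.sum_ne_top.2 fun n _ => measure_ne_top _ _
  have hYx : ∀ᵐ x ∂(streamLaw h), ∀ i : ℕ, lAlphaRatio α f₀ f₁ (x i) ≤ m := by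
    rw [ae_all_iff]
    intro i
    exact (measurePreserving_eval_infinitePi (fun _ : ℕ => h.law) i).quasiMeasurePreserving.ae hY
  have h1 : ENNReal.ofReal m * ∑ i ∈ Finset.range n, p i ≤
      ENNReal.ofReal z * ∑ i ∈ Finset.range n, p i + ENNReal.ofReal (b + d + m) := by
    calc ENNReal.ofReal m * ∑ i ∈ Finset.range n, p i
        = ∫⁻ x, ENNReal.ofReal m * ∑ i ∈ Finset.range n,
            (A i).indicator (1 : (ℕ → ℝ) → ℝ≥0∞) x ∂(streamLaw h) := by
          rw [lintegral_const_mul _ (Finset.measurable_sum _ fun i _ => hAm' i),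
            lintegral_finsetSum _ fun i _ => hAm' i]
          simp only [lintegral_indicator_one (hAm _), hp, hA]
      _ ≤ ∫⁻ x, (∑ i ∈ Finset.range n, (A i).indicator (1 : (ℕ → ℝ) → ℝ≥0∞) x * Z (x i) +
            ENNReal.ofReal (b + d + m)) ∂(streamLaw h) := by
          refine lintegral_mono_ae ?_
          filter_upwards [hYx] with x hx using mul_sum_indicator_staysBelow_le hc hm hx n
      _ = ∑ i ∈ Finset.range n, p i * ∫⁻ t, Z t ∂h.law + ENNReal.ofReal (b + d + m) := by
          rw [lintegral_add_right _ measurable_const,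
            lintegral_finsetSum (f := fun i x => (A i).indicator (1 : (ℕ → ℝ) → ℝ≥0∞) x * Z (x i))
              _ fun i _ => (hAm' i).mul (hZm' i)]
          simp only [lintegral_const, measure_univ, mul_one]
          congr 1
          refine Finset.sum_congr rfl fun i _ => ?_
          rw [lintegral_mul_eval h i (hAm' i) hZm
            (dependsOn_indicator_staysBelow α f₀ f₁ (b + d) i), lintegral_indicator_one (hAm i)]
      _ ≤ _ := by
          rw [← Finset.sum_mul, mul_comm]
          gcongr
  lift ∑ i ∈ Finset.range n, p i to ℝ≥0 using hfin with S
  rw [← ENNReal.ofReal_coe_nnreal, ← ENNReal.ofReal_mul hm.le, ← ENNReal.ofReal_mul hz,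
    ← ENNReal.ofReal_add (by positivity) (by positivity),
    ENNReal.ofReal_le_ofReal_iff (by positivity)] at h1
  rw [← ENNReal.ofReal_coe_nnreal]
  refine ENNReal.ofReal_le_ofReal ?_
  rw [le_div_iff₀ (by linarith)]
  linarith

/-! ### Exponential lower bound on the expected run length -/

lemma lintegral_exp_lAlphaCusum_le {α : ℝ} {f₀ f₁ : ProbDensity} {l : ℝ} (hl : 0 ≤ l)
    (h : ProbDensity) (hY : ∫⁻ t, (lAlphaRatio α f₀ f₁ t).exp ^ l ∂h.law ≤ 1) (n : ℕ) :
    ∫⁻ x, (lAlphaCusum α f₀ f₁ x n).exp ^ l ∂(streamLaw h) ≤ n + 1 := by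
  induction n with
  | zero => simp [lAlphaCusum]
  | succ n ih =>
    have hm := measurable_lAlphaCusum α f₀ f₁ n
    have hF : Measurable fun x : ℕ → ℝ => (lAlphaCusum α f₀ f₁ x n).exp ^ l :=
      hm.ereal_exp.pow_const l
    have hG : Measurable fun t => (lAlphaRatio α f₀ f₁ t).exp ^ l :=
      (measurable_lAlphaRatio α f₀ f₁).ereal_exp.pow_const l
    have hd : DependsOn (fun x : ℕ → ℝ => (lAlphaCusum α f₀ f₁ x n).exp ^ l)
        (Finset.range n : Set ℕ) := fun x y hxy => by
      have := dependsOn_lAlphaCusum α f₀ f₁ n hxy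
      simp only at this ⊢
      rw [this]
    calc ∫⁻ x, (lAlphaCusum α f₀ f₁ x (n + 1)).exp ^ l ∂(streamLaw h)
        ≤ ∫⁻ x, ((lAlphaCusum α f₀ f₁ x n).exp ^ l * (lAlphaRatio α f₀ f₁ (x n)).exp ^ l + 1)
            ∂(streamLaw h) := by
          refine lintegral_mono fun x => ?_
          rw [← ENNReal.mul_rpow_of_nonneg _ _ hl, ← EReal.exp_add]
          rcases le_total (lAlphaCusum α f₀ f₁ x n + lAlphaRatio α f₀ f₁ (x n)) 0 with h0 | h0
          · simp [lAlphaCusum, max_eq_right h0]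
          · simp [lAlphaCusum, max_eq_left h0]
      _ = (∫⁻ x, (lAlphaCusum α f₀ f₁ x n).exp ^ l ∂(streamLaw h)) *
            (∫⁻ t, (lAlphaRatio α f₀ f₁ t).exp ^ l ∂h.law) + 1 := by
          rw [lintegral_add_right _ measurable_const, lintegral_mul_eval h n hF hG hd]
          simp
      _ ≤ (n + 1) * 1 + 1 := by gcongr
      _ = ((n + 1 : ℕ) : ℝ≥0∞) + 1 := by push_cast; ring

lemma streamLaw_le_lAlphaCusum_le {α : ℝ} {f₀ f₁ : ProbDensity} {l : ℝ} (hl : 0 ≤ l)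
    (h : ProbDensity) (hY : ∫⁻ t, (lAlphaRatio α f₀ f₁ t).exp ^ l ∂h.law ≤ 1) (t : ℝ) (n : ℕ) :
    streamLaw h {x | (t : EReal) ≤ lAlphaCusum α f₀ f₁ x n} ≤
      ENNReal.ofReal ((n + 1) * Real.exp (-(l * t))) := by
  have hF : Measurable fun x : ℕ → ℝ => (lAlphaCusum α f₀ f₁ x n).exp ^ l :=
    (measurable_lAlphaCusum α f₀ f₁ n).ereal_exp.pow_const l
  have hsub : {x : ℕ → ℝ | (t : EReal) ≤ lAlphaCusum α f₀ f₁ x n} ⊆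
      {x | ENNReal.ofReal (Real.exp (l * t)) ≤ (lAlphaCusum α f₀ f₁ x n).exp ^ l} := by
    intro x hx
    have h1 : ENNReal.ofReal (Real.exp (l * t)) = (t : EReal).exp ^ l := by
      rw [EReal.exp_coe, ENNReal.ofReal_rpow_of_pos (Real.exp_pos t), ← Real.exp_mul, mul_comm]
    show ENNReal.ofReal (Real.exp (l * t)) ≤ (lAlphaCusum α f₀ f₁ x n).exp ^ l
    rw [h1]
    exact ENNReal.rpow_le_rpow (EReal.exp_monotone hx) hl
  have h2 := (mul_meas_ge_le_lintegral hF (ENNReal.ofReal (Real.exp (l * t)))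
    (μ := streamLaw h)).trans (lintegral_exp_lAlphaCusum_le hl h hY n)
  refine (measure_mono hsub).trans ?_
  have hpos : ENNReal.ofReal (Real.exp (l * t)) ≠ 0 := by simp [Real.exp_pos]
  rw [Real.exp_neg, ← div_eq_mul_inv, ENNReal.ofReal_div_of_pos (Real.exp_pos _)]
  refine (ENNReal.le_div_iff_mul_le (Or.inl hpos) (Or.inl ENNReal.ofReal_ne_top)).2 ?_
  rw [mul_comm]
  refine h2.trans (le_of_eq ?_)
  rw [ENNReal.ofReal_add n.cast_nonneg zero_le_one, ENNReal.ofReal_natCast, ENNReal.ofReal_one]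

lemma lt_softThresholdScheme {α : ℝ} {f₀ f₁ : ProbDensity} {K : ℕ} (hK : 1 ≤ K) {d b : ℝ}
    (hd : 0 ≤ d) (hb : 0 < b) {ω : ℕ × Fin K → ℝ} {n : ℕ}
    (hω : ∀ j ∈ Finset.range (n + 1), ∀ k,
      lAlphaCusum α f₀ f₁ (fun i => ω (i, k)) j < ((b / (2 * K) : ℝ) : EReal)) :
    ((n + 1 : ℕ) : ℕ∞) ≤ softThresholdScheme α f₀ f₁ K d b ω := by
  refine le_iInf₂ fun j hj => ?_
  by_contra hlt
  have hjn : j < n + 1 := by exact_mod_cast not_le.1 hlt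
  have hK0 : (0 : ℝ) < K := by exact_mod_cast hK
  have h1 : ∀ k : Fin K, max 0 (lAlphaCusum α f₀ f₁ (fun i => ω (i, k)) j - (d : EReal)) ≤
      ((b / (2 * K) : ℝ) : EReal) := by
    intro k
    refine max_le (EReal.coe_le_coe_iff.2 (by positivity)) ?_
    refine (EReal.sub_le_sub (hω j (by simpa using hjn) k).le
      (EReal.coe_le_coe_iff.2 hd)).trans ?_
    simp
  have h2 := hj.2.trans (Finset.sum_le_card_nsmul _ _ _ fun k _ => h1 k)
  rw [Finset.card_univ, Fintype.card_fin, ← EReal.coe_nsmul, EReal.coe_le_coe_iff,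
    nsmul_eq_mul] at h2
  have : (K : ℝ) * (b / (2 * K)) = b / 2 := by field_simp
  rw [this] at h2
  linarith

/-- If `E e^{lY} ≤ 1`, the expected run length is exponentially large in the threshold, with
constants that do not depend on the density. -/
lemma exists_exp_le_expectedRunLength {α : ℝ} {f₀ f₁ : ProbDensity} {K : ℕ} (hK : 1 ≤ K) {d : ℝ}
    (hd : 0 ≤ d) {l : ℝ} (hl : 0 < l) :
    ∃ s B : ℝ, 0 < s ∧ ∀ h : ProbDensity,
      ∫⁻ t, (lAlphaRatio α f₀ f₁ t).exp ^ l ∂h.law ≤ 1 → ∀ b, B ≤ b →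
      ENNReal.ofReal (Real.exp (s * b) / 2) ≤
        expectedRunLength h (softThresholdScheme α f₀ f₁ K d b) := by
  have hK0 : (0 : ℝ) < K := by exact_mod_cast hK
  refine ⟨l / (8 * K), max 1 (4 * K / l * Real.log (8 * K)), by positivity, fun h hY b hb => ?_⟩
  have hb1 : 1 ≤ b := (le_max_left _ _).trans hb
  set s := l / (8 * K) with hs
  have hs0 : 0 < s := by positivity
  have hbig : 8 * K ≤ Real.exp (2 * s * b) := by
    have h1 : 4 * K / l * Real.log (8 * K) ≤ b := (le_max_right _ _).trans hb
    rw [← Real.log_le_iff_le_exp (by positivity)]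
    have h2 : 2 * s * (4 * K / l * Real.log (8 * K)) = Real.log (8 * K) := by
      rw [hs]; field_simp; ring
    rw [← h2]
    gcongr
  set n := ⌊Real.exp (s * b)⌋₊ with hn
  have hn1 : Real.exp (s * b) < n + 1 := Nat.lt_floor_add_one _
  have hn2 : (n : ℝ) ≤ Real.exp (s * b) := Nat.floor_le (Real.exp_pos _).le
  have hone : 1 ≤ Real.exp (s * b) := Real.one_le_exp (by positivity)
  set t : ℝ := b / (2 * K) with ht
  set P := Measure.infinitePi fun _ : ℕ × Fin K => h.law with hP
  set bad : ℕ → Fin K → Set (ℕ × Fin K → ℝ) := fun j k =>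
    {ω | (t : EReal) ≤ lAlphaCusum α f₀ f₁ (fun i => ω (i, k)) j} with hbad
  have hbadm : ∀ j k, MeasurableSet (bad j k) := fun j k =>
    measurableSet_le measurable_const
      ((measurable_lAlphaCusum α f₀ f₁ j).comp (measurable_stream k))
  have hbadP : ∀ j ∈ Finset.range (n + 1), ∀ k,
      P (bad j k) ≤ ENNReal.ofReal ((n + 1) * Real.exp (-(l * t))) := by
    intro j hj k
    have h1 : P (bad j k) = streamLaw h {x | (t : EReal) ≤ lAlphaCusum α f₀ f₁ x j} := by
      rw [← map_stream h k, Measure.map_apply (measurable_stream k)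
        (measurableSet_le measurable_const (measurable_lAlphaCusum α f₀ f₁ j))]
      rfl
    rw [h1]
    refine (streamLaw_le_lAlphaCusum_le hl.le h hY t j).trans (ENNReal.ofReal_le_ofReal ?_)
    have : (j : ℝ) ≤ n := by exact_mod_cast Nat.lt_succ_iff.1 (Finset.mem_range.1 hj)
    gcongr
  set U : Set (ℕ × Fin K → ℝ) := ⋃ j ∈ Finset.range (n + 1), ⋃ k, bad j k with hU
  have hUm : MeasurableSet U :=
    Finset.measurableSet_biUnion _ fun j _ => MeasurableSet.iUnion fun k => hbadm j k
  have hUP : P U ≤ ENNReal.ofReal (1 / 2) := by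
    calc P U ≤ ∑ j ∈ Finset.range (n + 1), P (⋃ k, bad j k) := measure_biUnion_finset_le _ _
      _ ≤ ∑ j ∈ Finset.range (n + 1), ∑ k, P (bad j k) :=
          Finset.sum_le_sum fun j _ => measure_iUnion_fintype_le _ _
      _ ≤ ∑ j ∈ Finset.range (n + 1), ∑ _k : Fin K,
            ENNReal.ofReal ((n + 1) * Real.exp (-(l * t))) :=
          Finset.sum_le_sum fun j hj => Finset.sum_le_sum fun k _ => hbadP j hj k
      _ = ENNReal.ofReal ((n + 1) * (K * ((n + 1) * Real.exp (-(l * t))))) := by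
          rw [ENNReal.ofReal_mul (p := (n : ℝ) + 1)
              (q := K * ((n + 1) * Real.exp (-(l * t)))) (by positivity),
            ENNReal.ofReal_mul (p := (K : ℝ)) (by positivity), ENNReal.ofReal_natCast,
            ENNReal.ofReal_add n.cast_nonneg zero_le_one, ENNReal.ofReal_natCast,
            ENNReal.ofReal_one]
          simp
      _ ≤ ENNReal.ofReal (1 / 2) := by
          refine ENNReal.ofReal_le_ofReal ?_
          have e1 : Real.exp (-(l * t)) =
              (Real.exp (2 * s * b))⁻¹ * ((Real.exp (s * b))⁻¹ * (Real.exp (s * b))⁻¹) := by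
            rw [← Real.exp_neg, ← Real.exp_neg, ← Real.exp_add, ← Real.exp_add]
            congr 1
            rw [ht, hs]; field_simp; ring
          have e2 : ((n : ℝ) + 1) * (Real.exp (s * b))⁻¹ ≤ 2 := by
            rw [← div_eq_mul_inv, div_le_iff₀ (Real.exp_pos _)]
            linarith
          have e3 : (K : ℝ) * (Real.exp (2 * s * b))⁻¹ ≤ 1 / 8 := by
            rw [← div_eq_mul_inv, div_le_iff₀ (Real.exp_pos _)]
            linarith
          calc ((n : ℝ) + 1) * (K * ((n + 1) * Real.exp (-(l * t))))
              = (K * (Real.exp (2 * s * b))⁻¹) * ((((n : ℝ) + 1) * (Real.exp (s * b))⁻¹) *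
                (((n : ℝ) + 1) * (Real.exp (s * b))⁻¹)) := by rw [e1]; ring
            _ ≤ 1 / 8 * (2 * 2) := by gcongr
            _ = 1 / 2 := by norm_num
  have hUc : ENNReal.ofReal (1 / 2) ≤ P Uᶜ := by
    rw [prob_compl_eq_one_sub hUm]
    refine le_trans ?_ (tsub_le_tsub_left hUP 1)
    rw [← ENNReal.ofReal_one, ← ENNReal.ofReal_sub _ (by norm_num)]
    norm_num
  calc ENNReal.ofReal (Real.exp (s * b) / 2)
      ≤ ENNReal.ofReal ((n + 1) * (1 / 2)) := ENNReal.ofReal_le_ofReal (by linarith)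
    _ = ((n + 1 : ℕ) : ℝ≥0∞) * ENNReal.ofReal (1 / 2) := by
        rw [ENNReal.ofReal_mul (by positivity), ← Nat.cast_succ, ENNReal.ofReal_natCast]
    _ ≤ ((n + 1 : ℕ) : ℝ≥0∞) * P Uᶜ := by gcongr
    _ = ∫⁻ ω, Uᶜ.indicator (fun _ => ((n + 1 : ℕ) : ℝ≥0∞)) ω ∂P := by
        rw [lintegral_indicator_const hUm.compl]
    _ ≤ expectedRunLength h (softThresholdScheme α f₀ f₁ K d b) := by
        refine lintegral_mono fun ω => ?_
        by_cases hω : ω ∈ U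
        · rw [Set.indicator_of_notMem (by simpa using hω)]
          exact zero_le
        · rw [Set.indicator_of_mem (by simpa using hω)]
          have h1 : ((n + 1 : ℕ) : ℕ∞) ≤ softThresholdScheme α f₀ f₁ K d b ω := by
            refine lt_softThresholdScheme hK hd (by linarith) fun j hj k => ?_
            by_contra hge
            exact hω (Set.mem_biUnion hj (Set.mem_iUnion.2 ⟨k, not_lt.1 hge⟩))
          simpa using ENat.toENNReal_le.2 h1

/-! ### Contamination classes and densities -/

lemma lintegral_law (p : ProbDensity) {F : ℝ → ℝ≥0∞} (hF : Measurable F) :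
    ∫⁻ x, F x ∂p.law = ∫⁻ x, ENNReal.ofReal (p x) * F x :=
  lintegral_withDensity_eq_lintegral_mul _ p.measurable'.ennreal_ofReal hF

lemma ae_law_iff (p : ProbDensity) {P : ℝ → Prop} :
    (∀ᵐ x ∂p.law, P x) ↔ ∀ᵐ x, p x ≠ 0 → P x := by
  rw [ProbDensity.law, ae_withDensity_iff p.measurable'.ennreal_ofReal]
  refine eventually_congr (Eventually.of_forall fun x => ?_)
  have : ENNReal.ofReal (p x) ≠ 0 ↔ p x ≠ 0 := by
    rw [Ne, ENNReal.ofReal_eq_zero, Ne, (p.nonneg' x).ge_iff_eq']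
  rw [this]

lemma ae_law_of_ae (p : ProbDensity) {P : ℝ → Prop} (h : ∀ᵐ x, P x) : ∀ᵐ x ∂p.law, P x :=
  (ae_law_iff p).2 (h.mono fun _ hx _ => hx)

/-- A contaminated law is the mixture of the idealized law and the contamination. -/
lemma law_eq_of_contamination {f₀ h g : ProbDensity} {ε : ℝ} (hε0 : 0 ≤ ε) (hε1 : ε ≤ 1)
    (hh : ∀ x, h x = (1 - ε) * f₀ x + ε * g x) :
    h.law = ENNReal.ofReal (1 - ε) • f₀.law + ENNReal.ofReal ε • g.law := by
  have h1 : (fun x => ENNReal.ofReal (h x)) =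
      (ENNReal.ofReal (1 - ε) • fun x => ENNReal.ofReal (f₀ x)) +
        (ENNReal.ofReal ε • fun x => ENNReal.ofReal (g x)) := by
    funext x
    have h0 := f₀.nonneg' x
    have h1 := g.nonneg' x
    simp only [Pi.add_apply, Pi.smul_apply, smul_eq_mul]
    rw [hh, ENNReal.ofReal_add (mul_nonneg (by linarith) h0) (mul_nonneg hε0 h1),
      ENNReal.ofReal_mul (by linarith), ENNReal.ofReal_mul hε0]
  rw [ProbDensity.law, h1, withDensity_add_left (f₀.measurable'.ennreal_ofReal.const_smul _),
    withDensity_smul _ f₀.measurable'.ennreal_ofReal, withDensity_smul _ g.measurable'.ennreal_ofReal]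
  rfl

lemma lintegral_contamination {f₀ h g : ProbDensity} {ε : ℝ} (hε0 : 0 ≤ ε) (hε1 : ε ≤ 1)
    (hh : ∀ x, h x = (1 - ε) * f₀ x + ε * g x) (F : ℝ → ℝ≥0∞) :
    ∫⁻ x, F x ∂h.law = ENNReal.ofReal (1 - ε) * ∫⁻ x, F x ∂f₀.law +
      ENNReal.ofReal ε * ∫⁻ x, F x ∂g.law := by
  rw [law_eq_of_contamination hε0 hε1 hh, lintegral_add_measure, lintegral_smul_measure,
    lintegral_smul_measure]
  rfl

/-- The contamination class contains every mixture of `f₀` with a density. -/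
lemma exists_mem_contaminationClass (f₀ g : ProbDensity) {ε : ℝ} (hε0 : 0 ≤ ε) (hε1 : ε ≤ 1) :
    ∃ h ∈ contaminationClass f₀ ε, ∀ x, h x = (1 - ε) * f₀ x + ε * g x := by
  have h0 : ∀ x, 0 ≤ (1 - ε) * f₀ x := fun x => mul_nonneg (by linarith) (f₀.nonneg' x)
  have h1 : ∀ x, 0 ≤ ε * g x := fun x => mul_nonneg hε0 (g.nonneg' x)
  refine ⟨⟨fun x => (1 - ε) * f₀ x + ε * g x,
    (f₀.measurable'.const_mul _).add (g.measurable'.const_mul _),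
    fun x => add_nonneg (h0 x) (h1 x), ?_⟩, ⟨g, fun x => rfl⟩, fun x => rfl⟩
  simp_rw [fun x => ENNReal.ofReal_add (h0 x) (h1 x), ENNReal.ofReal_mul hε0,
    ENNReal.ofReal_mul (show 0 ≤ 1 - ε by linarith)]
  rw [lintegral_add_left (f₀.measurable'.ennreal_ofReal.const_mul _),
    lintegral_const_mul _ f₀.measurable'.ennreal_ofReal,
    lintegral_const_mul _ g.measurable'.ennreal_ofReal, f₀.lintegral_eq_one',
    g.lintegral_eq_one', mul_one, mul_one, ← ENNReal.ofReal_add (by linarith) hε0]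
  simp

lemma self_mem_contaminationClass (f₀ : ProbDensity) (ε : ℝ) : f₀ ∈ contaminationClass f₀ ε :=
  ⟨f₀, fun x => by ring⟩

/-- A set of positive Lebesgue measure carries a probability density. -/
lemma exists_density_of_volume_ne_zero {s : Set ℝ} (hs : MeasurableSet s) (h : volume s ≠ 0) :
    ∃ g : ProbDensity, ∀ᵐ x ∂g.law, x ∈ s := by
  obtain ⟨t, hts, htm, ht0, htt⟩ : ∃ t ⊆ s, MeasurableSet t ∧ 0 < volume t ∧ volume t < ⊤ := by
    obtain ⟨t, htm, hts, h1, h2⟩ :=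
      Measure.exists_subset_measure_lt_top (μ := volume) hs (pos_iff_ne_zero.2 h)
    exact ⟨t, hts, htm, h1, h2⟩
  refine ⟨⟨t.indicator fun _ => (volume t).toReal⁻¹, measurable_const.indicator htm,
    fun x => Set.indicator_nonneg (fun _ _ => by positivity) x, ?_⟩, ?_⟩
  · have h1 : ∀ x, ENNReal.ofReal (t.indicator (fun _ => (volume t).toReal⁻¹) x) =
        t.indicator (fun _ => (volume t)⁻¹) x := by
      intro x
      by_cases hx : x ∈ t
      · rw [Set.indicator_of_mem hx, Set.indicator_of_mem hx,
          ENNReal.ofReal_inv_of_pos (ENNReal.toReal_pos ht0.ne' htt.ne),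
          ENNReal.ofReal_toReal htt.ne]
      · rw [Set.indicator_of_notMem hx, Set.indicator_of_notMem hx, ENNReal.ofReal_zero]
    simp_rw [h1]
    rw [lintegral_indicator_const htm, ENNReal.inv_mul_cancel ht0.ne' htt.ne]
  · rw [ae_law_iff]
    refine Eventually.of_forall fun x hx => hts ?_
    exact Set.mem_of_indicator_ne_zero (f := fun _ => (volume t).toReal⁻¹) hx

/-! ### The drift under the idealized model: logarithmic increments -/

lemma absolutelyContinuous_law_iff (f₀ f₁ : ProbDensity) :
    f₀.law ≪ f₁.law ↔ ∀ᵐ x, f₁ x = 0 → f₀ x = 0 := by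
  constructor
  · intro h
    have h1 : ∀ᵐ x ∂f₁.law, f₁ x ≠ 0 := (ae_law_iff f₁).2 (Eventually.of_forall fun _ hx => hx)
    filter_upwards [(ae_law_iff f₀).1 (h.ae_le h1)] with x hx hx1
    by_contra h0
    exact hx h0 hx1
  · intro h s hs
    have h1 : ∀ᵐ x ∂f₁.law, x ∉ s := measure_eq_zero_iff_ae_notMem.1 hs
    refine measure_eq_zero_iff_ae_notMem.2 ((ae_law_iff f₀).2 ?_)
    filter_upwards [(ae_law_iff f₁).1 h1, h] with x hx hx0 hx1
    exact hx fun h => hx1 (hx0 h)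

lemma law_eq_withDensity_div {f₀ f₁ : ProbDensity} (h : f₀.law ≪ f₁.law) :
    f₀.law = f₁.law.withDensity fun x => ENNReal.ofReal (f₀ x / f₁ x) := by
  have hm : Measurable fun x => ENNReal.ofReal (f₀ x / f₁ x) :=
    (f₀.measurable'.div f₁.measurable').ennreal_ofReal
  rw [ProbDensity.law, ProbDensity.law, ← withDensity_mul _ f₁.measurable'.ennreal_ofReal hm]
  refine withDensity_congr_ae ?_
  filter_upwards [(absolutelyContinuous_law_iff f₀ f₁).1 h] with x hx
  rw [Pi.mul_apply, ← ENNReal.ofReal_mul (f₁.nonneg' x)]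
  by_cases h1 : f₁ x = 0
  · rw [hx h1]; simp
  · rw [mul_div_cancel₀ _ h1]

lemma lAlphaRatio_zero_of_pos {f₀ f₁ : ProbDensity} {x : ℝ} (h₀ : 0 < f₀ x) (h₁ : 0 < f₁ x) :
    lAlphaRatio 0 f₀ f₁ x = ((Real.log (f₁ x) - Real.log (f₀ x) : ℝ) : EReal) := by
  rw [lAlphaRatio, if_pos rfl, if_neg (fun h => h₀.ne' h.1), ENNReal.log_ofReal_of_pos h₀,
    ENNReal.log_ofReal_of_pos h₁, EReal.coe_sub]

lemma lAlphaRatio_zero_eq_top {f₀ f₁ : ProbDensity} {x : ℝ} (h₀ : f₀ x = 0) (h₁ : 0 < f₁ x) :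
    lAlphaRatio 0 f₀ f₁ x = ⊤ := by
  rw [lAlphaRatio, if_pos rfl, if_neg (fun h => h₁.ne' h.2), ENNReal.log_ofReal_of_pos h₁, h₀]
  simp

lemma lAlphaRatio_zero_eq_bot {f₀ f₁ : ProbDensity} {x : ℝ} (h₀ : 0 < f₀ x) (h₁ : f₁ x = 0) :
    lAlphaRatio 0 f₀ f₁ x = ⊥ := by
  rw [lAlphaRatio, if_pos rfl, if_neg (fun h => h₀.ne' h.1), ENNReal.log_ofReal_of_pos h₀, h₁]
  simp

lemma rnDeriv_law {f₀ f₁ : ProbDensity} (h : f₀.law ≪ f₁.law) :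
    f₀.law.rnDeriv f₁.law =ᵐ[f₁.law] fun x => ENNReal.ofReal (f₀ x / f₁ x) := by
  conv_lhs => rw [law_eq_withDensity_div h]
  exact Measure.rnDeriv_withDensity _ (f₀.measurable'.div f₁.measurable').ennreal_ofReal

lemma klDiv_law_eq {f₀ f₁ : ProbDensity} (h : f₀.law ≪ f₁.law) :
    InformationTheory.klDiv f₀.law f₁.law = ∫⁻ x, ENNReal.ofReal (f₁ x) *
      ENNReal.ofReal (InformationTheory.klFun (f₀ x / f₁ x)) := by
  have hm : Measurable fun x => f₀ x / f₁ x := f₀.measurable'.div f₁.measurable'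
  have hk : Measurable fun x => ENNReal.ofReal (InformationTheory.klFun (f₀ x / f₁ x)) :=
    (InformationTheory.measurable_klFun.comp hm).ennreal_ofReal
  rw [InformationTheory.klDiv_eq_lintegral_klFun_of_ac h, ← lintegral_law f₁ hk]
  refine lintegral_congr_ae ?_
  filter_upwards [rnDeriv_law h] with x hx
  rw [hx, ENNReal.toReal_ofReal (div_nonneg (f₀.nonneg' x) (f₁.nonneg' x))]

lemma lintegral_incrementGap_zero {f₀ f₁ : ProbDensity} {m : ℝ} (hm : 0 ≤ m)
    (hY : ∀ᵐ x, lAlphaRatio 0 f₀ f₁ x ≤ m) :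
    ∫⁻ x, incrementGap 0 f₀ f₁ m x ∂f₀.law =
      InformationTheory.klDiv f₀.law f₁.law + ENNReal.ofReal m := by
  by_cases hac : f₀.law ≪ f₁.law
  · have hD : Measurable fun x => ENNReal.ofReal (f₁ x) *
        ENNReal.ofReal (InformationTheory.klFun (f₀ x / f₁ x)) :=
      f₁.measurable'.ennreal_ofReal.mul (InformationTheory.measurable_klFun.comp
        (f₀.measurable'.div f₁.measurable')).ennreal_ofReal
    have hG := measurable_incrementGap 0 f₀ f₁ m
    have key : ∫⁻ x, (ENNReal.ofReal (f₁ x) *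
          ENNReal.ofReal (InformationTheory.klFun (f₀ x / f₁ x)) +
          ENNReal.ofReal m * ENNReal.ofReal (f₀ x) + ENNReal.ofReal (f₀ x)) =
        ∫⁻ x, (ENNReal.ofReal (f₀ x) * incrementGap 0 f₀ f₁ m x + ENNReal.ofReal (f₁ x)) := by
      refine lintegral_congr_ae ?_
      filter_upwards [hY, (absolutelyContinuous_law_iff f₀ f₁).1 hac] with x hx hx0
      rcases (f₁.nonneg' x).eq_or_lt with h1 | h1
      · rw [← h1, hx0 h1.symm]; simp
      · rcases (f₀.nonneg' x).eq_or_lt with h0 | h0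
        · rw [lAlphaRatio_zero_eq_top h0.symm h1] at hx
          simp at hx
        · rw [incrementGap, lAlphaRatio_zero_of_pos h0 h1, ← EReal.coe_sub,
            EReal.real_coe_toENNReal]
          rw [lAlphaRatio_zero_of_pos h0 h1, EReal.coe_le_coe_iff] at hx
          have hk := InformationTheory.klFun_nonneg (div_nonneg h0.le h1.le)
          rw [← ENNReal.ofReal_mul h1.le, ← ENNReal.ofReal_mul hm, ← ENNReal.ofReal_mul h0.le,
            ← ENNReal.ofReal_add (mul_nonneg h1.le hk) (mul_nonneg hm h0.le),
            ← ENNReal.ofReal_add (add_nonneg (mul_nonneg h1.le hk) (mul_nonneg hm h0.le)) h0.le,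
            ← ENNReal.ofReal_add (mul_nonneg h0.le (by linarith)) h1.le]
          congr 1
          rw [InformationTheory.klFun, Real.log_div h0.ne' h1.ne']
          field_simp
          ring
    rw [lintegral_add_right _ f₀.measurable'.ennreal_ofReal,
      lintegral_add_right _ (f₀.measurable'.ennreal_ofReal.const_mul _),
      lintegral_add_right _ f₁.measurable'.ennreal_ofReal,
      lintegral_const_mul _ f₀.measurable'.ennreal_ofReal, f₀.lintegral_eq_one',
      f₁.lintegral_eq_one', ← klDiv_law_eq hac, ← lintegral_law f₀ hG, mul_one] at key
    exact ((ENNReal.add_left_inj ENNReal.one_ne_top).1 key).symm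
  · rw [InformationTheory.klDiv_of_not_ac hac, top_add]
    by_contra hne
    refine hac ((absolutelyContinuous_law_iff f₀ f₁).2 ?_)
    have h1 := (ae_law_iff f₀).1 (ae_lt_top (measurable_incrementGap 0 f₀ f₁ m) hne)
    filter_upwards [h1] with x hx hx1
    by_contra h0
    have := hx h0
    rw [incrementGap, lAlphaRatio_zero_eq_bot ((f₀.nonneg' x).lt_of_ne' h0) hx1] at this
    simp at this

/-! ### The drift under the idealized model: power increments -/

/-- The integrand of the density power divergence at a point where `f₀` is `u` and `f₁` is `v`. -/
noncomputable def powerDivergenceIntegrand (α u v : ℝ) : ℝ :=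
  v ^ (1 + α) - (1 + 1 / α) * u * v ^ α + 1 / α * u ^ (1 + α)

/-- Bernoulli's inequality at `u / v - 1`, in homogeneous form. -/
lemma powerDivergenceIntegrand_pos {α u v : ℝ} (hα : 0 < α) (hu : 0 ≤ u) (hv : 0 ≤ v)
    (huv : u ≠ v) : 0 < powerDivergenceIntegrand α u v := by
  unfold powerDivergenceIntegrand
  rcases hv.eq_or_lt with rfl | hv
  · have hu' : 0 < u := hu.lt_of_ne' huv
    rw [Real.zero_rpow (by linarith), Real.zero_rpow hα.ne']
    simp only [mul_zero, sub_zero, zero_add]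
    positivity
  · have h1 : 1 + (1 + α) * (u / v - 1) < (1 + (u / v - 1)) ^ (1 + α) := by
      refine one_add_mul_self_lt_rpow_one_add ?_ ?_ (by linarith)
      · have : 0 ≤ u / v := by positivity
        linarith
      · intro h
        exact huv ((div_eq_one_iff_eq hv.ne').1 (by linarith))
    have hvp : v ^ (1 + α) = v * v ^ α := by rw [Real.rpow_add hv, Real.rpow_one]
    rw [add_sub_cancel, Real.div_rpow hu hv.le, lt_div_iff₀ (by positivity), hvp] at h1
    have h2 : (1 + (1 + α) * (u / v - 1)) * (v * v ^ α) =
        (1 + α) * (u * v ^ α) - α * (v * v ^ α) := by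
      field_simp
      ring
    rw [h2] at h1
    rw [hvp]
    have h3 : v * v ^ α - (1 + 1 / α) * u * v ^ α + 1 / α * u ^ (1 + α) =
        1 / α * (u ^ (1 + α) - ((1 + α) * (u * v ^ α) - α * (v * v ^ α))) := by
      field_simp
      ring
    rw [h3]
    exact mul_pos (by positivity) (by linarith)

lemma powerDivergenceIntegrand_self {α u : ℝ} (hα : 0 < α) (hu : 0 ≤ u) :
    powerDivergenceIntegrand α u u = 0 := by
  unfold powerDivergenceIntegrand
  rcases hu.eq_or_lt with rfl | hu
  · rw [Real.zero_rpow (by linarith), Real.zero_rpow hα.ne']; simp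
  · rw [Real.rpow_add hu, Real.rpow_one]; ring

lemma powerDivergenceIntegrand_nonneg {α u v : ℝ} (hα : 0 < α) (hu : 0 ≤ u) (hv : 0 ≤ v) :
    0 ≤ powerDivergenceIntegrand α u v := by
  by_cases h : u = v
  · rw [h, powerDivergenceIntegrand_self hα hv]
  · exact (powerDivergenceIntegrand_pos hα hu hv h).le

lemma densityPowerDivergence_of_pos {α : ℝ} (hα : 0 < α) (f₀ f₁ : ProbDensity) :
    densityPowerDivergence α f₀ f₁ =
      ∫⁻ x, ENNReal.ofReal (powerDivergenceIntegrand α (f₀ x) (f₁ x)) :=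
  if_neg hα.ne'

lemma measurable_powerDivergenceIntegrand (α : ℝ) (f₀ f₁ : ProbDensity) :
    Measurable fun x => ENNReal.ofReal (powerDivergenceIntegrand α (f₀ x) (f₁ x)) := by
  have h₀ := f₀.measurable'
  have h₁ := f₁.measurable'
  exact (((h₁.pow_const _).sub ((h₀.const_mul _).mul (h₁.pow_const _))).add
    ((h₀.pow_const _).const_mul _)).ennreal_ofReal

/-- The sum of a density over the orbit of `x` under the translations by multiples of `T`. -/
noncomputable def orbitSum (f : ProbDensity) (T x : ℝ) : ℝ≥0∞ :=
  ∑' g : AddSubgroup.zmultiples T, ENNReal.ofReal (f (g +ᵥ x))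

lemma measurable_orbitSum (f : ProbDensity) (T : ℝ) : Measurable (orbitSum f T) :=
  Measurable.tsum fun g => (f.measurable'.comp (measurable_const_vadd g)).ennreal_ofReal

lemma orbitSum_vadd (f : ProbDensity) (T x : ℝ) (g : AddSubgroup.zmultiples T) :
    orbitSum f T (g +ᵥ x) = orbitSum f T x := by
  unfold orbitSum
  rw [← (Equiv.addRight g).tsum_eq fun g' : AddSubgroup.zmultiples T =>
    ENNReal.ofReal (f (g' +ᵥ x))]
  refine tsum_congr fun g' => ?_
  rw [Equiv.coe_addRight, add_vadd]

lemma le_orbitSum (f : ProbDensity) (T x : ℝ) : ENNReal.ofReal (f x) ≤ orbitSum f T x := by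
  have := ENNReal.le_tsum (f := fun g : AddSubgroup.zmultiples T => ENNReal.ofReal (f (g +ᵥ x))) 0
  simpa [orbitSum] using this

/-- The orbit sums of a density are almost everywhere finite, since their integral over a period is
the integral of the density over the line. -/
lemma ae_orbitSum_lt_top (f : ProbDensity) {T : ℝ} (hT : 0 < T) :
    ∀ᵐ x, orbitSum f T x < ⊤ := by
  have hfd : IsAddFundamentalDomain (AddSubgroup.zmultiples T) (Set.Ioc (0 : ℝ) (0 + T)) :=
    isAddFundamentalDomain_Ioc hT 0
  have hint : ∫⁻ x in Set.Ioc (0 : ℝ) (0 + T), orbitSum f T x = 1 := by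
    unfold orbitSum
    rw [lintegral_tsum (f := fun (g : AddSubgroup.zmultiples T) x => ENNReal.ofReal (f (g +ᵥ x)))
      fun g => (f.measurable'.comp (measurable_const_vadd g)).ennreal_ofReal.aemeasurable,
      ← hfd.lintegral_eq_tsum'' fun x => ENNReal.ofReal (f x)]
    exact f.lintegral_eq_one'
  have hm := measurable_orbitSum f T
  have h1 : ∀ᵐ x ∂volume.restrict (Set.Ioc (0 : ℝ) (0 + T)), orbitSum f T x < ⊤ :=
    ae_lt_top hm (by rw [hint]; exact ENNReal.one_ne_top)
  have hms : MeasurableSet {x | orbitSum f T x = ⊤} := hm (measurableSet_singleton ⊤)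
  have h2 : volume ({x | orbitSum f T x = ⊤} ∩ Set.Ioc (0 : ℝ) (0 + T)) = 0 := by
    rw [← Measure.restrict_apply hms, measure_eq_zero_iff_ae_notMem]
    exact h1.mono fun x hx => hx.ne
  have h3 := hfd.measure_zero_of_invariant {x | orbitSum f T x = ⊤} (fun g => by
    ext x
    rw [Set.mem_vadd_set_iff_neg_vadd_mem]
    show orbitSum f T (-g +ᵥ x) = ⊤ ↔ orbitSum f T x = ⊤
    rw [orbitSum_vadd]) h2
  exact (measure_eq_zero_iff_ae_notMem.1 h3).mono fun x hx => lt_top_iff_ne_top.2 hx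

/-- Pointwise identity between the divergence integrand and the weighted increment; the terms
`f₁ ^ (1 + α)` and `f₀ ^ (1 + α)` are translates of each other. -/
lemma powerDivergenceIntegrand_add {α m : ℝ} (hα : 0 < α) (hm : 0 ≤ m) {f₀ f₁ : ProbDensity}
    {x : ℝ} (hx : lAlphaRatio α f₀ f₁ x ≤ m) :
    ENNReal.ofReal (powerDivergenceIntegrand α (f₀ x) (f₁ x)) +
        ENNReal.ofReal ((1 + α) * m) * ENNReal.ofReal (f₀ x) + ENNReal.ofReal (f₀ x ^ (1 + α)) =
      ENNReal.ofReal (1 + α) * (ENNReal.ofReal (f₀ x) * incrementGap α f₀ f₁ m x) +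
        ENNReal.ofReal (f₁ x ^ (1 + α)) := by
  have h0 := f₀.nonneg' x
  have h1 := f₁.nonneg' x
  have hD := powerDivergenceIntegrand_nonneg hα h0 h1
  have hY : lAlphaRatio α f₀ f₁ x = (((f₁ x ^ α - f₀ x ^ α) / α : ℝ) : EReal) := if_neg hα.ne'
  rw [hY, EReal.coe_le_coe_iff] at hx
  rw [incrementGap, hY, ← EReal.coe_sub, EReal.real_coe_toENNReal]
  have hp0 : 0 ≤ f₀ x ^ (1 + α) := Real.rpow_nonneg h0 _
  have hp1 : 0 ≤ f₁ x ^ (1 + α) := Real.rpow_nonneg h1 _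
  have e1 : 0 ≤ (1 + α) * m * f₀ x := by positivity
  have e2 : 0 ≤ (1 + α) * (f₀ x * (m - (f₁ x ^ α - f₀ x ^ α) / α)) :=
    mul_nonneg (by linarith) (mul_nonneg h0 (by linarith))
  rw [← ENNReal.ofReal_mul (by positivity), ← ENNReal.ofReal_mul h0,
    ← ENNReal.ofReal_mul (by linarith), ← ENNReal.ofReal_add hD e1,
    ← ENNReal.ofReal_add (add_nonneg hD e1) hp0, ← ENNReal.ofReal_add e2 hp1]
  congr 1
  unfold powerDivergenceIntegrand
  have hpow : f₀ x ^ (1 + α) = f₀ x * f₀ x ^ α := by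
    rw [Real.rpow_add_of_nonneg h0 zero_le_one hα.le, Real.rpow_one]
  rw [hpow]
  field_simp
  ring

/-- The mean of `m - Y` is `m + d_α / (1 + α)`.  Formally `∫ f₁ ^ (1 + α)` and `∫ f₀ ^ (1 + α)`
cancel, but these integrals may be infinite.  On the translation-invariant set where the orbit sum
of the density is at most `L` they are finite, and these sets exhaust almost all of the line. -/
lemma lintegral_incrementGap_pos {f : ProbDensity} {θ₀ θ₁ α m : ℝ} (hθ : θ₀ ≠ θ₁) (hα : 0 < α)
    (hm : 0 ≤ m) (hY : ∀ᵐ x, lAlphaRatio α (f.shift θ₀) (f.shift θ₁) x ≤ m) :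
    ENNReal.ofReal (1 + α) *
        ∫⁻ x, incrementGap α (f.shift θ₀) (f.shift θ₁) m x ∂(f.shift θ₀).law =
      densityPowerDivergence α (f.shift θ₀) (f.shift θ₁) + ENNReal.ofReal ((1 + α) * m) := by
  set f₀ := f.shift θ₀ with hf₀
  set f₁ := f.shift θ₁ with hf₁
  set T := |θ₁ - θ₀| with hT
  have hT0 : 0 < T := abs_pos.2 (sub_ne_zero.2 hθ.symm)
  have hmem : -(θ₁ - θ₀) ∈ AddSubgroup.zmultiples T := by
    rw [neg_mem_iff, hT]
    rcases abs_choice (θ₁ - θ₀) with h | h <;> rw [h]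
    · exact AddSubgroup.mem_zmultiples _
    · exact neg_mem_iff.1 (AddSubgroup.mem_zmultiples _)
  set S := orbitSum f₀ T with hS
  have hSshift : ∀ x, S (x - (θ₁ - θ₀)) = S x := by
    intro x
    have := orbitSum_vadd f₀ T x ⟨_, hmem⟩
    refine Eq.trans ?_ this
    show S _ = S _
    congr 1
    show x - (θ₁ - θ₀) = -(θ₁ - θ₀) + x
    ring
  have hf₁x : ∀ x, f₁ x = f₀ (x - (θ₁ - θ₀)) := by
    intro x
    show f (x - θ₁) = f (x - (θ₁ - θ₀) - θ₀)
    congr 1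
    ring
  set B : ℕ → Set ℝ := fun L => {x | S x ≤ L} with hB
  have hBm : ∀ L, MeasurableSet (B L) := fun L =>
    measurableSet_le (measurable_orbitSum f₀ T) measurable_const
  have hG := measurable_incrementGap α f₀ f₁ m
  have hD := measurable_powerDivergenceIntegrand α f₀ f₁
  have hP0 : Measurable fun x => ENNReal.ofReal (f₀ x ^ (1 + α)) :=
    (f₀.measurable'.pow_const _).ennreal_ofReal
  have hP1 : Measurable fun x => ENNReal.ofReal (f₁ x ^ (1 + α)) :=
    (f₁.measurable'.pow_const _).ennreal_ofReal
  set u : ℝ → ℝ≥0∞ := fun x => ENNReal.ofReal (powerDivergenceIntegrand α (f₀ x) (f₁ x)) +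
    ENNReal.ofReal ((1 + α) * m) * ENNReal.ofReal (f₀ x) with hu
  set v : ℝ → ℝ≥0∞ := fun x => ENNReal.ofReal (1 + α) *
    (ENNReal.ofReal (f₀ x) * incrementGap α f₀ f₁ m x) with hv
  have hshift : ∀ L, ∫⁻ x in B L, ENNReal.ofReal (f₁ x ^ (1 + α)) =
      ∫⁻ x in B L, ENNReal.ofReal (f₀ x ^ (1 + α)) := by
    intro L
    rw [← lintegral_indicator (hBm L), ← lintegral_indicator (hBm L),
      ← lintegral_sub_right_eq_self
        ((B L).indicator fun x => ENNReal.ofReal (f₀ x ^ (1 + α))) (θ₁ - θ₀)]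
    refine lintegral_congr fun x => ?_
    have : x ∈ B L ↔ x - (θ₁ - θ₀) ∈ B L := by
      show S x ≤ L ↔ S (x - (θ₁ - θ₀)) ≤ L
      rw [hSshift]
    classical
    simp only [Set.indicator_apply, this, hf₁x x]
  have hfin : ∀ L, ∫⁻ x in B L, ENNReal.ofReal (f₀ x ^ (1 + α)) ≠ ⊤ := by
    intro L
    have h1 : ∫⁻ x in B L, ENNReal.ofReal (f₀ x ^ (1 + α)) ≤
        ∫⁻ x in B L, ENNReal.ofReal ((L : ℝ) ^ α) * ENNReal.ofReal (f₀ x) := by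
      refine setLIntegral_mono' (hBm L) fun x hx => ?_
      have h0 := f₀.nonneg' x
      have hxL : f₀ x ≤ L := by
        have h2 := (le_orbitSum f₀ T x).trans hx
        rw [← ENNReal.ofReal_natCast] at h2
        exact (ENNReal.ofReal_le_ofReal_iff L.cast_nonneg).1 h2
      rw [← ENNReal.ofReal_mul (by positivity), add_comm,
        Real.rpow_add_of_nonneg h0 hα.le zero_le_one, Real.rpow_one]
      exact ENNReal.ofReal_le_ofReal
        (mul_le_mul_of_nonneg_right (Real.rpow_le_rpow h0 hxL hα.le) h0)
    refine ne_top_of_le_ne_top ?_ (h1.trans (setLIntegral_le_lintegral _ _))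
    rw [lintegral_const_mul _ f₀.measurable'.ennreal_ofReal, f₀.lintegral_eq_one', mul_one]
    exact ENNReal.ofReal_ne_top
  have hBL : ∀ L, ∫⁻ x in B L, u x = ∫⁻ x in B L, v x := by
    intro L
    have h1 : ∫⁻ x in B L, (u x + ENNReal.ofReal (f₀ x ^ (1 + α))) =
        ∫⁻ x in B L, (v x + ENNReal.ofReal (f₁ x ^ (1 + α))) := by
      refine lintegral_congr_ae (ae_restrict_of_ae ?_)
      filter_upwards [hY] with x hx using powerDivergenceIntegrand_add hα hm hx
    rw [lintegral_add_right _ hP0, lintegral_add_right _ hP1, hshift L] at h1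
    exact (ENNReal.add_left_inj (hfin L)).1 h1
  have hdir : Directed (· ⊆ ·) B := by
    refine Monotone.directed_le fun L L' hL x hx => ?_
    exact le_trans (show S x ≤ L from hx) (by exact_mod_cast hL)
  have huniv : (⋃ L, B L : Set ℝ) =ᵐ[volume] Set.univ := by
    rw [eventuallyEq_univ]
    filter_upwards [ae_orbitSum_lt_top f₀ hT0] with x hx
    obtain ⟨L, hL⟩ := ENNReal.exists_nat_gt hx.ne
    exact Set.mem_iUnion.2 ⟨L, hL.le⟩
  have huv : ∫⁻ x, u x = ∫⁻ x, v x := by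
    rw [← setLIntegral_univ u, ← setLIntegral_univ v, ← setLIntegral_congr huniv,
      ← setLIntegral_congr huniv, setLIntegral_iUnion_of_directed u hdir,
      setLIntegral_iUnion_of_directed v hdir]
    exact iSup_congr hBL
  have hfG : Measurable fun x => ENNReal.ofReal (f₀ x) * incrementGap α f₀ f₁ m x :=
    f₀.measurable'.ennreal_ofReal.mul hG
  rw [hu, hv, lintegral_add_left hD, lintegral_const_mul _ f₀.measurable'.ennreal_ofReal,
    lintegral_const_mul _ hfG, f₀.lintegral_eq_one', mul_one, ← lintegral_law f₀ hG,
    ← densityPowerDivergence_of_pos hα] at huv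
  exact huv.symm

/-! ### The divergence and the intrinsic bound of a location family -/

lemma lintegral_incrementGap {f : ProbDensity} {θ₀ θ₁ α m : ℝ} (hθ : θ₀ ≠ θ₁) (hα : 0 ≤ α)
    (hm : 0 ≤ m) (hY : ∀ᵐ x, lAlphaRatio α (f.shift θ₀) (f.shift θ₁) x ≤ m) :
    ENNReal.ofReal (1 + α) *
        ∫⁻ x, incrementGap α (f.shift θ₀) (f.shift θ₁) m x ∂(f.shift θ₀).law =
      densityPowerDivergence α (f.shift θ₀) (f.shift θ₁) + ENNReal.ofReal ((1 + α) * m) := by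
  rcases hα.eq_or_lt with rfl | hα
  · rw [lintegral_incrementGap_zero hm hY, densityPowerDivergence, if_pos rfl]
    simp
  · exact lintegral_incrementGap_pos hθ hα hm hY

lemma densityPowerDivergence_ne_zero {f₀ f₁ : ProbDensity} (h₀ : Continuous f₀)
    (h₁ : Continuous f₁) {α : ℝ} (hα : 0 ≤ α) {x : ℝ} (hx : f₀ x ≠ f₁ x) :
    densityPowerDivergence α f₀ f₁ ≠ 0 := by
  intro h
  have hae : (f₀ : ℝ → ℝ) =ᵐ[volume] f₁ := by
    rcases hα.eq_or_lt with rfl | hα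
    · rw [densityPowerDivergence, if_pos rfl, InformationTheory.klDiv_eq_zero_iff,
        ProbDensity.law, ProbDensity.law, withDensity_eq_iff
          f₀.measurable'.ennreal_ofReal.aemeasurable f₁.measurable'.ennreal_ofReal.aemeasurable
          (by rw [f₀.lintegral_eq_one']; exact ENNReal.one_ne_top)] at h
      filter_upwards [h] with y hy
      exact (ENNReal.ofReal_eq_ofReal_iff (f₀.nonneg' y) (f₁.nonneg' y)).1 hy
    · rw [densityPowerDivergence_of_pos hα,
        lintegral_eq_zero_iff (measurable_powerDivergenceIntegrand α f₀ f₁)] at h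
      filter_upwards [h] with y hy
      by_contra hne
      have := powerDivergenceIntegrand_pos hα (f₀.nonneg' y) (f₁.nonneg' y) hne
      exact absurd (ENNReal.ofReal_eq_zero.1 hy) (not_le.2 this)
  exact hx (congrFun ((h₀.ae_eq_iff_eq volume h₁).1 hae) x)

lemma lAlphaRatio_pos {α : ℝ} (hα : 0 ≤ α) {f₀ f₁ : ProbDensity} {x : ℝ} (hx : f₀ x < f₁ x) :
    0 < lAlphaRatio α f₀ f₁ x := by
  have h0 := f₀.nonneg' x
  rcases hα.eq_or_lt with rfl | hα
  · rcases h0.eq_or_lt with h0 | h0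
    · rw [lAlphaRatio_zero_eq_top h0.symm (h0 ▸ hx)]
      exact EReal.zero_lt_top
    · rw [lAlphaRatio_zero_of_pos h0 (h0.trans hx)]
      exact EReal.coe_pos.2 (sub_pos.2 (Real.log_lt_log h0 hx))
  · rw [lAlphaRatio, if_neg hα.ne']
    exact EReal.coe_pos.2 (div_pos (sub_pos.2 (Real.rpow_lt_rpow h0 hx hα)) hα)

lemma intrinsicBound_pos {f₀ f₁ : ProbDensity} (h₀ : Continuous f₀) (h₁ : Continuous f₁)
    {α : ℝ} (hα : 0 ≤ α) {x : ℝ} (hx : f₀ x < f₁ x) : 0 < intrinsicBound α f₀ f₁ := by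
  by_contra hle
  have h1 : ∀ᵐ y, lAlphaRatio α f₀ f₁ y ≤ 0 :=
    (ae_le_essSup (f := lAlphaRatio α f₀ f₁)).mono fun y hy => hy.trans (not_lt.1 hle)
  have h2 : volume {y | f₀ y < f₁ y} = 0 := by
    rw [measure_eq_zero_iff_ae_notMem]
    exact h1.mono fun y hy hlt => absurd (lAlphaRatio_pos hα hlt) (not_lt.2 hy)
  exact ((isOpen_lt h₀ h₁).measure_pos volume ⟨x, hx⟩).ne' h2

lemma volume_lt_lAlphaRatio_ne_zero {α : ℝ} {f₀ f₁ : ProbDensity} {t : ℝ}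
    (ht : (t : EReal) < intrinsicBound α f₀ f₁) :
    volume {x | (t : EReal) < lAlphaRatio α f₀ f₁ x} ≠ 0 := by
  intro h
  have h1 : ∀ᵐ x, lAlphaRatio α f₀ f₁ x ≤ t :=
    (measure_eq_zero_iff_ae_notMem.1 h).mono fun x hx => not_lt.1 hx
  exact absurd (essSup_le_of_ae_le _ h1) (not_le.2 ht)

/-! ### Exponential moments, uniformly over a contamination class -/

lemma exp_neg_le_quadratic {x : ℝ} (hx : 0 ≤ x) : Real.exp (-x) ≤ 1 - x + x ^ 2 := by
  rw [Real.exp_neg, inv_le_comm₀ (Real.exp_pos x) (by nlinarith [sq_nonneg (x - 1)])]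
  refine le_trans ?_ (Real.add_one_le_exp x)
  rw [inv_le_comm₀ (by nlinarith [sq_nonneg (x - 1)]) (by linarith),
    inv_le_iff_one_le_mul₀ (by linarith)]
  nlinarith [pow_nonneg hx 3]

lemma exp_lAlphaRatio_rpow_le {α m l z : ℝ} {f₀ f₁ : ProbDensity} {x : ℝ} (hl : 0 ≤ l)
    (hx : lAlphaRatio α f₀ f₁ x ≤ m)
    (hz : ENNReal.ofReal z ≤ incrementGap α f₀ f₁ m x) :
    (lAlphaRatio α f₀ f₁ x).exp ^ l ≤ ENNReal.ofReal (Real.exp (l * (m - z))) := by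
  have h1 : lAlphaRatio α f₀ f₁ x ≤ ((m - z : ℝ) : EReal) := by
    rw [incrementGap] at hz
    generalize lAlphaRatio α f₀ f₁ x = y at hx hz ⊢
    induction y with
    | bot => exact bot_le
    | top => simp at hx
    | coe y =>
      rw [EReal.coe_le_coe_iff] at hx ⊢
      rw [← EReal.coe_sub, EReal.real_coe_toENNReal,
        ENNReal.ofReal_le_ofReal_iff (by linarith)] at hz
      linarith
  refine (ENNReal.rpow_le_rpow (EReal.exp_monotone h1) hl).trans (le_of_eq ?_)
  rw [EReal.exp_coe, ENNReal.ofReal_rpow_of_pos (Real.exp_pos _), ← Real.exp_mul, mul_comm]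

/-- If the increment keeps a negative mean under the worst contamination of level `ε`, which puts
all its mass where the increment is near its bound `m`, then one exponential moment is at most `1`
for the whole class.  The gap `m - Y` is truncated first, since it may have no mean. -/
lemma exists_exp_moment_le_one {α m ε : ℝ} {f₀ f₁ : ProbDensity} (hε0 : 0 ≤ ε) (hε1 : ε < 1)
    (hm : 0 ≤ m) (hY : ∀ᵐ x, lAlphaRatio α f₀ f₁ x ≤ m)
    (hgap : ENNReal.ofReal m < ENNReal.ofReal (1 - ε) * ∫⁻ x, incrementGap α f₀ f₁ m x ∂f₀.law) :
    ∃ l : ℝ, 0 < l ∧ ∀ h ∈ contaminationClass f₀ ε,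
      ∫⁻ x, (lAlphaRatio α f₀ f₁ x).exp ^ l ∂h.law ≤ 1 := by
  have hG := measurable_incrementGap α f₀ f₁ m
  obtain ⟨A, hA⟩ : ∃ A : ℕ, ENNReal.ofReal m <
      ENNReal.ofReal (1 - ε) * ∫⁻ x, min (incrementGap α f₀ f₁ m x) A ∂f₀.law := by
    have h1 : ∫⁻ x, incrementGap α f₀ f₁ m x ∂f₀.law =
        ⨆ A : ℕ, ∫⁻ x, min (incrementGap α f₀ f₁ m x) A ∂f₀.law := by
      rw [← lintegral_iSup (fun A => hG.min measurable_const)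
        (fun A A' hA x => min_le_min_left _ (by exact_mod_cast hA))]
      refine lintegral_congr fun x => ?_
      rw [← inf_iSup_eq, ENNReal.iSup_natCast, inf_top_eq]
    rw [h1, ENNReal.mul_iSup, lt_iSup_iff] at hgap
    exact hgap
  set z : ℝ → ℝ := fun x => (min (incrementGap α f₀ f₁ m x) A).toReal with hz
  have hzof : ∀ x, ENNReal.ofReal (z x) = min (incrementGap α f₀ f₁ m x) A := fun x =>
    ENNReal.ofReal_toReal (ne_top_of_le_ne_top (ENNReal.natCast_ne_top A) (min_le_right _ _))
  have hz0 : ∀ x, 0 ≤ z x := fun x => ENNReal.toReal_nonneg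
  have hzA : ∀ x, z x ≤ A := by
    intro x
    have h1 : ENNReal.ofReal (z x) ≤ A := by rw [hzof]; exact min_le_right _ _
    rw [← ENNReal.ofReal_natCast] at h1
    exact (ENNReal.ofReal_le_ofReal_iff A.cast_nonneg).1 h1
  have hI : ∫⁻ x, min (incrementGap α f₀ f₁ m x) A ∂f₀.law ≠ ⊤ := by
    refine ne_top_of_le_ne_top (ENNReal.natCast_ne_top A)
      ((lintegral_mono fun x => min_le_right _ _).trans ?_)
    simp
  set J := (∫⁻ x, min (incrementGap α f₀ f₁ m x) A ∂f₀.law).toReal with hJ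
  have hJof : ∫⁻ x, ENNReal.ofReal (z x) ∂f₀.law = ENNReal.ofReal J := by
    rw [hJ, ENNReal.ofReal_toReal hI]
    exact lintegral_congr hzof
  have hJ0 : 0 ≤ J := ENNReal.toReal_nonneg
  have hJm : m < (1 - ε) * J := by
    rw [← ENNReal.ofReal_toReal hI, ← ENNReal.ofReal_mul (by linarith)] at hA
    exact (ENNReal.ofReal_lt_ofReal_iff_of_nonneg hm).1 hA
  -- the quadratic remainder `l ^ 2 * A ^ 2` must not exceed `l * ((1 - ε) * J - m)`
  set l := ((1 - ε) * J - m) / ((A : ℝ) ^ 2 + 1) with hl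
  have hl0 : 0 < l := div_pos (by linarith) (by positivity)
  have hlA : l * (A : ℝ) ^ 2 ≤ (1 - ε) * J - m := by
    have h1 : l * ((A : ℝ) ^ 2 + 1) = (1 - ε) * J - m := by
      rw [hl]; field_simp
    nlinarith
  have hexp : Measurable fun x => (lAlphaRatio α f₀ f₁ x).exp ^ l :=
    (measurable_lAlphaRatio α f₀ f₁).ereal_exp.pow_const l
  have hzm : Measurable fun x => ENNReal.ofReal (z x) := by
    simp only [hzof]
    exact hG.min measurable_const
  set a := Real.exp (l * m) * (l * J) with ha
  set b := Real.exp (l * m) * (1 + l ^ 2 * (A : ℝ) ^ 2) with hb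
  have hpt : ∀ᵐ x, (lAlphaRatio α f₀ f₁ x).exp ^ l +
      ENNReal.ofReal (Real.exp (l * m) * l) * ENNReal.ofReal (z x) ≤ ENNReal.ofReal b := by
    filter_upwards [hY] with x hx
    have h1 := exp_lAlphaRatio_rpow_le (z := z x) hl0.le hx
      (by rw [hzof]; exact min_le_left _ _)
    refine (add_le_add_left h1 _).trans ?_
    have hzx := hz0 x
    have hzx' := hzA x
    rw [← ENNReal.ofReal_mul (by positivity), ← ENNReal.ofReal_add (by positivity) (by positivity)]
    refine ENNReal.ofReal_le_ofReal ?_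
    have h2 : Real.exp (l * (m - z x)) = Real.exp (l * m) * Real.exp (-(l * z x)) := by
      rw [← Real.exp_add]; congr 1; ring
    have h3 := exp_neg_le_quadratic (mul_nonneg hl0.le hzx)
    have h4 : (l * z x) ^ 2 ≤ l ^ 2 * (A : ℝ) ^ 2 := by
      rw [mul_pow]
      gcongr
    calc Real.exp (l * (m - z x)) + Real.exp (l * m) * l * z x
        = Real.exp (l * m) * (Real.exp (-(l * z x)) + l * z x) := by rw [h2]; ring
      _ ≤ b := by
          rw [hb]
          exact mul_le_mul_of_nonneg_left (by linarith) (Real.exp_pos _).le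
  have h0 : ∫⁻ x, (lAlphaRatio α f₀ f₁ x).exp ^ l ∂f₀.law + ENNReal.ofReal a ≤
      ENNReal.ofReal b := by
    have h1 := lintegral_mono_ae (ae_law_of_ae f₀ hpt)
    rw [lintegral_add_left hexp, lintegral_const_mul _ hzm, hJof,
      ← ENNReal.ofReal_mul (by positivity), lintegral_const, measure_univ, mul_one, mul_assoc] at h1
    exact h1
  have hab : a ≤ b := by
    rw [← ENNReal.ofReal_le_ofReal_iff (by positivity)]
    exact le_add_self.trans h0
  have h0' : ∫⁻ x, (lAlphaRatio α f₀ f₁ x).exp ^ l ∂f₀.law ≤ ENNReal.ofReal (b - a) := by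
    rw [ENNReal.ofReal_sub _ (by positivity)]
    exact ENNReal.le_sub_of_add_le_right ENNReal.ofReal_ne_top h0
  refine ⟨l, hl0, ?_⟩
  rintro h ⟨g, hg⟩
  have h1 : ∫⁻ x, (lAlphaRatio α f₀ f₁ x).exp ^ l ∂g.law ≤ ENNReal.ofReal (Real.exp (l * m)) := by
    calc _ ≤ ∫⁻ _, ENNReal.ofReal (Real.exp (l * m)) ∂g.law := by
          refine lintegral_mono_ae (ae_law_of_ae g ?_)
          filter_upwards [hY] with x hx
          simpa using exp_lAlphaRatio_rpow_le (z := 0) hl0.le hx (by simp)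
      _ = _ := by simp
  rw [lintegral_contamination hε0 hε1.le hg]
  refine (add_le_add (mul_le_mul_right h0' _) (mul_le_mul_right h1 _)).trans ?_
  rw [← ENNReal.ofReal_mul (by linarith), ← ENNReal.ofReal_mul hε0,
    ← ENNReal.ofReal_add (mul_nonneg (by linarith) (by linarith)) (by positivity),
    ENNReal.ofReal_le_one]
  have h2 : (1 - ε) * (b - a) + ε * Real.exp (l * m) ≤ Real.exp (l * m) * (1 - l * m) := by
    have h3 : (1 - ε) * (b - a) + ε * Real.exp (l * m) = Real.exp (l * m) *
        (1 + (1 - ε) * (l * (l * (A : ℝ) ^ 2)) - l * ((1 - ε) * J)) := by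
      rw [ha, hb]; ring
    rw [h3]
    have h4 : l * (l * (A : ℝ) ^ 2) ≤ l * ((1 - ε) * J - m) :=
      mul_le_mul_of_nonneg_left hlA hl0.le
    have h5 : (1 - ε) * (l * (l * (A : ℝ) ^ 2)) ≤ l * (l * (A : ℝ) ^ 2) := by
      have : 0 ≤ l * (l * (A : ℝ) ^ 2) := by positivity
      nlinarith
    exact mul_le_mul_of_nonneg_left (by linarith) (Real.exp_pos _).le
  refine h2.trans ?_
  calc Real.exp (l * m) * (1 - l * m) ≤ Real.exp (l * m) * Real.exp (-(l * m)) := by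
        gcongr
        have := Real.add_one_le_exp (-(l * m))
        linarith
    _ = 1 := by rw [← Real.exp_add]; simp

/-! ### Thresholds that meet the false alarm constraint -/

/-- If the increment is almost surely nonpositive, the statistics never leave `0`. -/
lemma expectedRunLength_degenerate {α : ℝ} {f₀ f₁ : ProbDensity} {K : ℕ} {d : ℝ} (hd : 0 ≤ d)
    {h : ProbDensity} (hY : h.law {t | 0 < lAlphaRatio α f₀ f₁ t} = 0) (b : ℝ) :
    expectedRunLength h (softThresholdScheme α f₀ f₁ K d b) ≤ 1 ∨
      expectedRunLength h (softThresholdScheme α f₀ f₁ K d b) = ⊤ := by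
  set P := Measure.infinitePi fun _ : ℕ × Fin K => h.law with hP
  rcases le_or_gt b 0 with hb | hb
  · left
    calc expectedRunLength h (softThresholdScheme α f₀ f₁ K d b) ≤ ∫⁻ _, 1 ∂P := by
          refine lintegral_mono fun ω => ?_
          have h1 : softThresholdScheme α f₀ f₁ K d b ω ≤ (1 : ℕ) := by
            refine iInf₂_le 1 ⟨le_rfl, ?_⟩
            refine le_trans (EReal.coe_le_coe_iff.2 hb) ?_
            exact Finset.sum_nonneg fun k _ => le_max_left _ _
          simpa using ENat.toENNReal_le.2 h1
      _ = 1 := by simp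
  · right
    have h1 : ∀ᵐ t ∂h.law, lAlphaRatio α f₀ f₁ t ≤ 0 :=
      (measure_eq_zero_iff_ae_notMem.1 hY).mono fun t ht => not_lt.1 ht
    have h2 : ∀ᵐ ω ∂P, ∀ i : ℕ × Fin K, lAlphaRatio α f₀ f₁ (ω i) ≤ 0 := by
      rw [ae_all_iff]
      intro i
      exact (measurePreserving_eval_infinitePi (fun _ : ℕ × Fin K => h.law)
        i).quasiMeasurePreserving.ae h1
    have h3 : ∀ᵐ ω ∂P, ((softThresholdScheme α f₀ f₁ K d b ω : ℕ∞) : ℝ≥0∞) = ⊤ := by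
      filter_upwards [h2] with ω hω
      have hW : ∀ n k, lAlphaCusum α f₀ f₁ (fun i => ω (i, k)) n = 0 := by
        intro n k
        induction n with
        | zero => rfl
        | succ n ih =>
          rw [lAlphaCusum, ih, zero_add]
          exact max_eq_right (hω (n, k))
      have htop : softThresholdScheme α f₀ f₁ K d b ω = ⊤ := by
        refine iInf₂_eq_top.2 fun n hn => ?_
        exfalso
        have h4 := hn.2
        have h5 : max 0 ((0 : EReal) - (d : EReal)) = 0 := by
          refine max_eq_left ?_
          rw [← EReal.coe_zero, ← EReal.coe_sub, EReal.coe_le_coe_iff]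
          linarith
        simp only [hW, h5, Finset.sum_const_zero] at h4
        exact absurd (EReal.coe_nonpos.1 h4) (not_le.2 hb)
      rw [htop]
      rfl
    rw [expectedRunLength, lintegral_congr_ae h3]
    simp

lemma exists_pos_law_ne_zero {α : ℝ} {f₀ f₁ h : ProbDensity}
    (hY : h.law {t | 0 < lAlphaRatio α f₀ f₁ t} ≠ 0) :
    ∃ c : ℝ, 0 < c ∧ h.law {t | (c : EReal) ≤ lAlphaRatio α f₀ f₁ t} ≠ 0 := by
  by_contra hcon
  push Not at hcon
  refine hY (measure_mono_null (fun t ht => ?_) (measure_iUnion_null (s := fun n : ℕ =>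
    {t | ((1 / ((n : ℝ) + 1) : ℝ) : EReal) ≤ lAlphaRatio α f₀ f₁ t}) fun n =>
      hcon _ (by positivity)))
  obtain ⟨c, hc0, hc⟩ := EReal.lt_iff_exists_real_btwn.1 (show (0 : EReal) < _ from ht)
  obtain ⟨n, hn⟩ := exists_nat_one_div_lt (EReal.coe_pos.1 hc0)
  exact Set.mem_iUnion.2 ⟨n, (EReal.coe_le_coe_iff.2 hn.le).trans hc.le⟩

/-- The expected run length is at most exponential in the threshold as soon as the increment is
positive with positive probability. -/
lemma exists_expectedRunLength_le_exp {α : ℝ} {f₀ f₁ : ProbDensity} {K : ℕ} (hK : 1 ≤ K) {d : ℝ}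
    (hd : 0 ≤ d) {h : ProbDensity} (hY : h.law {t | 0 < lAlphaRatio α f₀ f₁ t} ≠ 0) :
    ∃ C : ℝ, 0 < C ∧ ∀ b, 1 ≤ b →
      expectedRunLength h (softThresholdScheme α f₀ f₁ K d b) ≤
        ENNReal.ofReal (Real.exp (C * b)) := by
  obtain ⟨c, hc, hq⟩ := exists_pos_law_ne_zero hY
  set q := (h.law {t | (c : EReal) ≤ lAlphaRatio α f₀ f₁ t}).toReal with hqdef
  have hqof : h.law {t | (c : EReal) ≤ lAlphaRatio α f₀ f₁ t} = ENNReal.ofReal q :=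
    (ENNReal.ofReal_toReal (measure_ne_top _ _)).symm
  have hq0 : 0 < q := ENNReal.toReal_pos hq (measure_ne_top _ _)
  have hq1 : q ≤ 1 := by
    rw [← ENNReal.ofReal_le_one, ← hqof]
    exact prob_le_one
  have hlog : Real.log q ≤ 0 := Real.log_nonpos hq0.le hq1
  set R := (1 + d) / c + 1 with hR
  have hR0 : 0 < R := by positivity
  refine ⟨R * (1 - Real.log q), mul_pos hR0 (by linarith), fun b hb => ?_⟩
  set r := ⌈(b + d) / c⌉₊ with hr
  have hr1 : 1 ≤ r := Nat.one_le_ceil_iff.2 (div_pos (by linarith) hc)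
  have hrc : b + d ≤ r * c := (div_le_iff₀ hc).1 (Nat.le_ceil _)
  have hrR : (r : ℝ) ≤ R * b := by
    have h1 : (r : ℝ) < (b + d) / c + 1 := Nat.ceil_lt_add_one (by positivity)
    have h2 : (b + d) / c ≤ (1 + d) / c * b := by
      rw [div_mul_eq_mul_div]
      gcongr
      nlinarith
    rw [hR, add_mul, one_mul]
    linarith
  have h1 := pow_mul_expectedRunLength_le (α := α) (f₀ := f₀) (f₁ := f₁) hK hr1 hrc h
  rw [hqof, ← ENNReal.ofReal_pow hq0.le, mul_comm] at h1
  have h2 := (ENNReal.le_div_iff_mul_le (Or.inl (by simpa using pow_pos hq0 r))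
    (Or.inl ENNReal.ofReal_ne_top)).2 h1
  rw [← ENNReal.ofReal_natCast, ← ENNReal.ofReal_div_of_pos (by positivity)] at h2
  refine h2.trans (ENNReal.ofReal_le_ofReal ?_)
  have h3 : (r : ℝ) ≤ Real.exp r := by
    have := Real.add_one_le_exp (r : ℝ)
    linarith
  have h4 : Real.exp (r * (1 - Real.log q)) = Real.exp r / q ^ r := by
    rw [mul_sub, mul_one, Real.exp_sub, mul_comm (r : ℝ) (Real.log q), Real.exp_mul,
      Real.exp_log hq0, Real.rpow_natCast]
  calc (r : ℝ) / q ^ r ≤ Real.exp r / q ^ r := by gcongr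
    _ = Real.exp (r * (1 - Real.log q)) := h4.symm
    _ ≤ Real.exp (R * (1 - Real.log q) * b) := by
        refine Real.exp_le_exp.2 ?_
        have := mul_le_mul_of_nonneg_right hrR (show 0 ≤ 1 - Real.log q by linarith)
        linarith

lemma eventually_between_of_constraint {K : ℕ} {f₀ : ProbDensity}
    {T : ℝ → (ℕ × Fin K → ℝ) → ℕ∞} {b : ℝ → ℝ} (h : SatisfiesFalseAlarmConstraint f₀ T b) :
    ∀ᶠ γ : ℝ in atTop, ENNReal.ofReal (γ / 2) ≤ expectedRunLength f₀ (T (b γ)) ∧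
      expectedRunLength f₀ (T (b γ)) ≤ ENNReal.ofReal (2 * γ) := by
  have h1 := h.eventually (lt_mem_nhds (show (2⁻¹ : ℝ≥0∞) < 1 by simp))
  have h2 := h.eventually (gt_mem_nhds (show (1 : ℝ≥0∞) < 2 by simp))
  filter_upwards [h1, h2, eventually_gt_atTop 0] with γ hγ1 hγ2 hγ
  have hpos : ENNReal.ofReal γ ≠ 0 := by simpa using hγ
  constructor
  · have := ENNReal.mul_le_of_le_div hγ1.le
    refine le_trans (le_of_eq ?_) this
    rw [div_eq_mul_inv, ENNReal.ofReal_mul hγ.le, mul_comm, ENNReal.ofReal_inv_of_pos two_pos]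
    simp
  · have := (ENNReal.div_le_iff_le_mul (Or.inl hpos) (Or.inl ENNReal.ofReal_ne_top)).1 hγ2.le
    refine this.trans (le_of_eq ?_)
    rw [ENNReal.ofReal_mul two_pos.le]
    simp

lemma law_pos_increment_ne_zero {α : ℝ} {f₀ f₁ : ProbDensity} {K : ℕ} {d : ℝ} (hd : 0 ≤ d)
    {b : ℝ → ℝ}
    (hb : SatisfiesFalseAlarmConstraint f₀ (softThresholdScheme α f₀ f₁ K d) b) :
    f₀.law {t | 0 < lAlphaRatio α f₀ f₁ t} ≠ 0 := by
  intro h0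
  obtain ⟨γ, ⟨h1, h2⟩, hγ⟩ :=
    ((eventually_between_of_constraint hb).and (eventually_gt_atTop 2)).exists
  rcases expectedRunLength_degenerate (K := K) hd h0 (b γ) with h | h
  · have := h1.trans h
    rw [ENNReal.ofReal_le_one] at this
    linarith
  · rw [h] at h2
    exact ENNReal.ofReal_ne_top (top_le_iff.1 h2)

/-- The thresholds grow at least logarithmically. -/
lemma exists_log_le_threshold {α : ℝ} {f₀ f₁ : ProbDensity} {K : ℕ} (hK : 1 ≤ K) {d : ℝ}
    (hd : 0 ≤ d) {b : ℝ → ℝ}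
    (hb : SatisfiesFalseAlarmConstraint f₀ (softThresholdScheme α f₀ f₁ K d) b) :
    ∃ c : ℝ, 0 < c ∧ ∀ᶠ γ : ℝ in atTop, c * Real.log γ ≤ b γ := by
  obtain ⟨C, hC, hE⟩ := exists_expectedRunLength_le_exp (K := K) hK hd
    (law_pos_increment_ne_zero hd hb)
  refine ⟨1 / (2 * C), by positivity, ?_⟩
  filter_upwards [eventually_between_of_constraint hb, eventually_gt_atTop 4,
    Real.tendsto_log_atTop.eventually (eventually_gt_atTop (2 * C))] with γ hγ hγ4 hγC
  have h1 := hγ.1.trans ((expectedRunLength_mono α f₀ f₁ K d f₀ (le_max_left (b γ) 1)).trans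
    (hE _ (le_max_right _ _)))
  rw [ENNReal.ofReal_le_ofReal_iff (Real.exp_pos _).le,
    ← Real.log_le_iff_le_exp (by linarith)] at h1
  have h2 : Real.log γ / 2 ≤ Real.log (γ / 2) := by
    have h3 : Real.log 4 ≤ Real.log γ := Real.log_le_log (by norm_num) hγ4.le
    have h4 : Real.log 4 = 2 * Real.log 2 := by
      rw [show (4 : ℝ) = 2 ^ 2 by norm_num, Real.log_pow]; norm_num
    rw [Real.log_div (by linarith) two_ne_zero]
    linarith
  have h3 : Real.log γ / 2 ≤ C * max (b γ) 1 := h2.trans h1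
  rcases le_total (b γ) 1 with hb1 | hb1
  · rw [max_eq_right hb1] at h3
    linarith
  · rw [max_eq_left hb1] at h3
    rw [one_div, inv_mul_le_iff₀ (by positivity)]
    linarith

/-- The thresholds grow at most logarithmically if the increment has an exponential moment bounded
by `1` under the idealized model. -/
lemma exists_threshold_le_log {α : ℝ} {f₀ f₁ : ProbDensity} {K : ℕ} (hK : 1 ≤ K) {d : ℝ}
    (hd : 0 ≤ d) {b : ℝ → ℝ}
    (hb : SatisfiesFalseAlarmConstraint f₀ (softThresholdScheme α f₀ f₁ K d) b)
    {l : ℝ} (hl : 0 < l) (hY : ∫⁻ t, (lAlphaRatio α f₀ f₁ t).exp ^ l ∂f₀.law ≤ 1) :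
    ∃ C : ℝ, 0 < C ∧ ∀ᶠ γ : ℝ in atTop, b γ ≤ C * Real.log γ := by
  obtain ⟨s, B, hs, hE⟩ := exists_exp_le_expectedRunLength (α := α) (f₀ := f₀) (f₁ := f₁) hK hd hl
  refine ⟨|B| + 2 / s, by positivity, ?_⟩
  filter_upwards [eventually_between_of_constraint hb, eventually_gt_atTop 4,
    Real.tendsto_log_atTop.eventually (eventually_gt_atTop 1)] with γ hγ hγ4 hγ1
  have h2 : 0 ≤ 2 / s * Real.log γ := by positivity
  have h3 : |B| ≤ |B| * Real.log γ := le_mul_of_one_le_right (abs_nonneg B) hγ1.le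
  rw [add_mul]
  rcases le_total (b γ) B with hbB | hbB
  · have := le_abs_self B
    linarith
  · have h1 := (hE f₀ hY _ hbB).trans hγ.2
    rw [ENNReal.ofReal_le_ofReal_iff (by linarith)] at h1
    have h4 : s * b γ ≤ Real.log (4 * γ) := by
      rw [Real.le_log_iff_exp_le (by linarith)]
      linarith
    have h5 : Real.log (4 * γ) ≤ 2 * Real.log γ := by
      rw [Real.log_mul (by norm_num) (by linarith)]
      have := Real.log_le_log (by norm_num : (0 : ℝ) < 4) hγ4.le
      linarith
    have h6 : b γ ≤ 2 / s * Real.log γ := by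
      rw [div_mul_eq_mul_div, le_div_iff₀ hs]
      linarith
    have := abs_nonneg B
    linarith

/-! ### Criteria for breakdown -/

/-- A family breaks down if, at every threshold, some contamination brings the expected run length
down to a subpolynomial size. -/
lemma breaksDown_of_eventually_le {α : ℝ} {f₀ f₁ : ProbDensity} {K : ℕ} {d : ℝ} {b : ℝ → ℝ}
    {ε : ℝ} {u : ℝ → ℝ}
    (hu : ∀ᶠ γ : ℝ in atTop, ∃ h ∈ contaminationClass f₀ ε,
      expectedRunLength h (softThresholdScheme α f₀ f₁ K d (b γ)) ≤ ENNReal.ofReal (u γ))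
    (hlim : Tendsto (fun γ => Real.log (u γ) / Real.log γ) atTop (𝓝 0)) :
    BreaksDown f₀ (softThresholdScheme α f₀ f₁ K d) b ε := by
  have hlim' : Tendsto (fun γ => ((Real.log (u γ) / Real.log γ : ℝ) : EReal)) atTop (𝓝 0) := by
    have := (continuous_coe_real_ereal.tendsto 0).comp hlim
    rwa [EReal.coe_zero] at this
  refine tendsto_of_tendsto_of_tendsto_of_le_of_le' tendsto_const_nhds hlim' ?_ ?_
  · filter_upwards [eventually_gt_atTop 1] with γ hγ
    refine EReal.div_nonneg (le_iInf₂ fun h _ => ?_)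
      (EReal.coe_nonneg.2 (Real.log_pos hγ).le)
    exact ENNReal.zero_le_log_iff.2 (one_le_expectedRunLength α f₀ f₁ K d (b γ) h)
  · filter_upwards [hu, eventually_gt_atTop 1] with γ ⟨h, hh, hle⟩ hγ
    have hu0 : 0 < u γ := by
      have := (one_le_expectedRunLength α f₀ f₁ K d (b γ) h).trans hle
      exact ENNReal.ofReal_pos.1 (zero_lt_one.trans_le this)
    rw [EReal.coe_div]
    refine EReal.div_le_div_right_of_nonneg (EReal.coe_nonneg.2 (Real.log_pos hγ).le) ?_
    refine (iInf₂_le h hh).trans ((ENNReal.log_monotone hle).trans (le_of_eq ?_))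
    exact ENNReal.log_ofReal_of_pos hu0

lemma not_breaksDown_of_eventually_le {K : ℕ} {f₀ : ProbDensity}
    {T : ℝ → (ℕ × Fin K → ℝ) → ℕ∞} {b : ℝ → ℝ} {ε κ : ℝ} (hκ : 0 < κ)
    (h : ∀ᶠ γ : ℝ in atTop, ∀ h ∈ contaminationClass f₀ ε,
      ENNReal.ofReal (Real.exp (κ * Real.log γ)) ≤ expectedRunLength h (T (b γ))) :
    ¬ BreaksDown f₀ T b ε := by
  intro hB
  have h1 : (κ : EReal) ≤ 0 := by
    refine ge_of_tendsto hB ?_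
    filter_upwards [h, eventually_gt_atTop 1] with γ hγ hγ1
    have hlog : 0 < Real.log γ := Real.log_pos hγ1
    rw [EReal.le_div_iff_mul_le (EReal.coe_pos.2 hlog) (EReal.coe_ne_top _)]
    refine le_iInf₂ fun g hg => ?_
    refine le_trans (le_of_eq ?_) (ENNReal.log_monotone (hγ g hg))
    rw [ENNReal.log_ofReal_of_pos (Real.exp_pos _), Real.log_exp, EReal.coe_mul]
  exact absurd (EReal.coe_nonpos.1 h1) (not_le.2 hκ)

/-- With unbounded increments every positive level of contamination breaks the scheme down: the
contamination may consist of observations that cross the threshold in one step. -/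
lemma breaksDown_of_intrinsicBound_eq_top {α : ℝ} {f₀ f₁ : ProbDensity} {K : ℕ} (hK : 1 ≤ K)
    {d ε : ℝ} (hε0 : 0 < ε) (hε1 : ε ≤ 1) (hM : intrinsicBound α f₀ f₁ = ⊤) (b : ℝ → ℝ) :
    BreaksDown f₀ (softThresholdScheme α f₀ f₁ K d) b ε := by
  refine breaksDown_of_eventually_le (u := fun _ => 1 / ε) (Eventually.of_forall fun γ => ?_)
    (Real.tendsto_log_atTop.const_div_atTop _)
  set s := {x | ((b γ + d : ℝ) : EReal) < lAlphaRatio α f₀ f₁ x} with hs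
  have hsm : MeasurableSet s := measurableSet_lt measurable_const (measurable_lAlphaRatio α f₀ f₁)
  obtain ⟨g, hg⟩ := exists_density_of_volume_ne_zero hsm
    (volume_lt_lAlphaRatio_ne_zero (by rw [hM]; exact EReal.coe_lt_top _))
  obtain ⟨h, hh, hhx⟩ := exists_mem_contaminationClass f₀ g hε0.le hε1
  refine ⟨h, hh, ?_⟩
  have hone : b γ + d ≤ ((1 : ℕ) : ℝ) * (b γ + d) := by rw [Nat.cast_one, one_mul]
  have h1 := pow_mul_expectedRunLength_le (α := α) (f₀ := f₀) (f₁ := f₁) hK le_rfl hone h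
  have hgs : g.law s = 1 := (prob_compl_eq_zero_iff hsm).1 (ae_iff.1 hg)
  have h2 : ENNReal.ofReal ε ≤ h.law {t | ((b γ + d : ℝ) : EReal) ≤ lAlphaRatio α f₀ f₁ t} := by
    refine le_trans ?_ (measure_mono (s := s) fun t ht =>
      (show ((b γ + d : ℝ) : EReal) < lAlphaRatio α f₀ f₁ t from ht).le)
    rw [law_eq_of_contamination hε0.le hε1 hhx, Measure.add_apply, Measure.smul_apply,
      Measure.smul_apply, hgs, smul_eq_mul, smul_eq_mul, mul_one]
    exact le_add_self
  rw [pow_one, Nat.cast_one] at h1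
  rw [ENNReal.ofReal_div_of_pos hε0, ENNReal.ofReal_one,
    ENNReal.le_div_iff_mul_le (Or.inl (by simpa using hε0)) (Or.inl ENNReal.ofReal_ne_top), mul_comm]
  exact (mul_le_mul_left h2 _).trans h1

lemma tendsto_log_affine_log_div_log {a c : ℝ} (ha : 0 < a) (hc : 0 < c) :
    Tendsto (fun γ => Real.log (a * Real.log γ + c) / Real.log γ) atTop (𝓝 0) := by
  have h1 : Tendsto (fun t : ℝ => Real.log (a * t + c) / t) atTop (𝓝 0) := by
    have h2 : Tendsto (fun t : ℝ => a * t + c) atTop atTop :=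
      tendsto_atTop_add_const_right _ _ (tendsto_id.const_mul_atTop ha)
    have h3 := (Real.isLittleO_log_id_atTop.comp_tendsto h2)
    have h4 : (fun t : ℝ => a * t + c) =O[atTop] fun t : ℝ => t := by
      refine Asymptotics.IsBigO.of_bound (a + c) ?_
      filter_upwards [eventually_ge_atTop 1] with t ht
      rw [Real.norm_of_nonneg (by positivity), Real.norm_of_nonneg (by positivity)]
      nlinarith
    exact (h3.trans_isBigO h4).tendsto_div_nhds_zero
  exact h1.comp Real.tendsto_log_atTop

/-- Contamination near the top of the increment that makes the drift positive breaks the scheme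
down: the run length becomes linear in the threshold, hence logarithmic in `γ`. -/
lemma breaksDown_of_drift_pos {α : ℝ} {f₀ f₁ : ProbDensity} {K : ℕ} (hK : 1 ≤ K) {d ε m μ : ℝ}
    (hd : 0 ≤ d) (hε0 : 0 < ε) (hε1 : ε ≤ 1) (hm : 0 < m) (hM : intrinsicBound α f₀ f₁ = m)
    (hμ0 : 0 ≤ μ) (hμ : ∫⁻ x, incrementGap α f₀ f₁ m x ∂f₀.law = ENNReal.ofReal μ)
    (hμm : (1 - ε) * μ < m) {b : ℝ → ℝ} {C : ℝ} (hC : 0 < C)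
    (hb : ∀ᶠ γ : ℝ in atTop, b γ ≤ C * Real.log γ) :
    BreaksDown f₀ (softThresholdScheme α f₀ f₁ K d) b ε := by
  have hY : ∀ᵐ x, lAlphaRatio α f₀ f₁ x ≤ m := hM ▸ ae_le_essSup
  set η := m - (1 - ε) * μ with hη
  have hη0 : 0 < η := sub_pos.2 hμm
  set s := {x | ((m - η / 2 : ℝ) : EReal) < lAlphaRatio α f₀ f₁ x} with hs
  have hsm : MeasurableSet s := measurableSet_lt measurable_const (measurable_lAlphaRatio α f₀ f₁)
  obtain ⟨g, hg⟩ := exists_density_of_volume_ne_zero hsm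
    (volume_lt_lAlphaRatio_ne_zero (by rw [hM]; exact EReal.coe_lt_coe_iff.2 (by linarith)))
  obtain ⟨h, hh, hhx⟩ := exists_mem_contaminationClass f₀ g hε0.le hε1
  set z := (1 - ε) * μ + ε * (η / 2) with hz
  have hz0 : 0 ≤ z := add_nonneg (mul_nonneg (by linarith) hμ0) (by positivity)
  have hzm : z < m := by
    have : ε * (η / 2) ≤ η / 2 := mul_le_of_le_one_left (by positivity) hε1
    linarith
  have hgap : ∫⁻ t, incrementGap α f₀ f₁ m t ∂h.law ≤ ENNReal.ofReal z := by
    have h1 : ∫⁻ t, incrementGap α f₀ f₁ m t ∂g.law ≤ ENNReal.ofReal (η / 2) := by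
      calc _ ≤ ∫⁻ _, ENNReal.ofReal (η / 2) ∂g.law := by
            refine lintegral_mono_ae (hg.mono fun t ht => ?_)
            refine (EReal.toENNReal_le_toENNReal (EReal.sub_le_sub le_rfl (le_of_lt ht))).trans ?_
            rw [← EReal.coe_sub, EReal.real_coe_toENNReal]
            simp
        _ = _ := by simp
    rw [lintegral_contamination hε0.le hε1 hhx, hμ, hz,
      ENNReal.ofReal_add (mul_nonneg (by linarith) hμ0) (by positivity),
      ENNReal.ofReal_mul (by linarith), ENNReal.ofReal_mul hε0.le]
    gcongr
  have hmz : 0 < m - z := by linarith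
  refine breaksDown_of_eventually_le
    (u := fun γ => C / (m - z) * Real.log γ + (1 + d + m) / (m - z)) ?_
    (tendsto_log_affine_log_div_log (by positivity) (by positivity))
  filter_upwards [hb, eventually_gt_atTop 1] with γ hbγ hγ
  have hlog := Real.log_pos hγ
  refine ⟨h, hh, ?_⟩
  -- enlarging the threshold makes it positive, as the drift bound requires
  refine (expectedRunLength_mono α f₀ f₁ K d h (show b γ ≤ C * Real.log γ + 1 by linarith)).trans
    ((expectedRunLength_le_of_drift hK (by positivity) hm hz0 hzm h (ae_law_of_ae h hY)
      hgap).trans (ENNReal.ofReal_le_ofReal (le_of_eq ?_)))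
  field_simp
  ring

/-- As long as the drift stays negative over the whole contamination class, the expected run
lengths are bounded below by a fixed power of `γ`. -/
lemma not_breaksDown_of_drift_neg {α : ℝ} {f₀ f₁ : ProbDensity} {K : ℕ} (hK : 1 ≤ K) {d ε m : ℝ}
    (hd : 0 ≤ d) (hε0 : 0 ≤ ε) (hε1 : ε < 1) (hm : 0 ≤ m)
    (hY : ∀ᵐ x, lAlphaRatio α f₀ f₁ x ≤ m)
    (hgap : ENNReal.ofReal m < ENNReal.ofReal (1 - ε) * ∫⁻ x, incrementGap α f₀ f₁ m x ∂f₀.law)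
    {b : ℝ → ℝ} (hb : SatisfiesFalseAlarmConstraint f₀ (softThresholdScheme α f₀ f₁ K d) b) :
    ¬ BreaksDown f₀ (softThresholdScheme α f₀ f₁ K d) b ε := by
  obtain ⟨l, hl, hL⟩ := exists_exp_moment_le_one hε0 hε1 hm hY hgap
  obtain ⟨s, B, hs, hE⟩ := exists_exp_le_expectedRunLength (α := α) (f₀ := f₀) (f₁ := f₁) hK hd hl
  obtain ⟨c, hc, hbc⟩ := exists_log_le_threshold hK hd hb
  have hsc : 0 < s * c := by positivity
  refine not_breaksDown_of_eventually_le (κ := s * c / 2) (by positivity) ?_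
  have hlim := Real.tendsto_log_atTop.const_mul_atTop hc
  have hlim' := Real.tendsto_log_atTop.const_mul_atTop (half_pos hsc)
  filter_upwards [hbc, hlim.eventually (eventually_ge_atTop B),
    hlim'.eventually (eventually_ge_atTop (Real.log 2))] with γ h1 h2 h3 h hh
  refine le_trans (ENNReal.ofReal_le_ofReal ?_) (hE h (hL h hh) _ (h2.trans h1))
  have h4 : s * c / 2 * Real.log γ + Real.log 2 ≤ s * b γ := by
    have h5 := mul_le_mul_of_nonneg_left h1 hs.le
    have h6 : s * (c * Real.log γ) = s * c / 2 * Real.log γ + s * c / 2 * Real.log γ := by ring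
    linarith
  have h7 := Real.exp_le_exp.2 h4
  rw [Real.exp_add, Real.exp_log two_pos] at h7
  linarith

lemma falseAlarmBreakdownPoint_eq {K : ℕ} {f₀ : ProbDensity} {T : ℝ → (ℕ × Fin K → ℝ) → ℕ∞}
    {b : ℝ → ℝ} {e : ℝ} (he : e ≤ 1)
    (h1 : ∀ ε, 0 ≤ ε → ε < e → ¬ BreaksDown f₀ T b ε)
    (h2 : ∀ ε, 0 ≤ ε → e < ε → ε < 1 → BreaksDown f₀ T b ε) (he0 : 0 ≤ e) :
    falseAlarmBreakdownPoint f₀ T b = e := by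
  have hne : (insert 1 {ε : ℝ | 0 ≤ ε ∧ ε < 1 ∧ BreaksDown f₀ T b ε}).Nonempty :=
    ⟨1, Set.mem_insert _ _⟩
  refine csInf_eq_of_forall_ge_of_forall_gt_exists_lt hne ?_ ?_
  · rintro ε (rfl | ⟨hε0, -, hB⟩)
    · exact he
    · by_contra hlt
      exact h1 ε hε0 (not_le.1 hlt) hB
  · intro w hw
    rcases he.eq_or_lt with rfl | he
    · exact ⟨1, Set.mem_insert _ _, hw⟩
    · obtain ⟨ε, hε1, hε2⟩ := exists_between (lt_min hw he)
      have hε3 := lt_min_iff.1 hε2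
      exact ⟨ε, Set.mem_insert_of_mem _ ⟨he0.trans hε1.le, hε3.2,
        h2 ε (he0.trans hε1.le) hε1 hε3.2⟩, hε3.1⟩

/-! ### Gaussian location families -/

section Gaussian

open ProbabilityTheory

lemma shift_eq_gaussianPDFReal {f : ProbDensity} {v : ℝ≥0}
    (hf : ∀ x, f x = gaussianPDFReal 0 v x) (θ x : ℝ) :
    f.shift θ x = gaussianPDFReal θ v x := by
  show f (x - θ) = _
  rw [hf, gaussianPDFReal_sub, zero_add]

lemma law_shift_eq_gaussianReal {f : ProbDensity} {v : ℝ≥0} (hv : v ≠ 0)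
    (hf : ∀ x, f x = gaussianPDFReal 0 v x) (θ : ℝ) :
    (f.shift θ).law = gaussianReal θ v := by
  rw [gaussianReal_of_var_ne_zero θ hv, ProbDensity.law]
  congr 1
  funext x
  rw [shift_eq_gaussianPDFReal hf, gaussianPDF]

lemma log_gaussianPDFReal_sub {v : ℝ≥0} (hv : v ≠ 0) (θ₀ θ₁ x : ℝ) :
    Real.log (gaussianPDFReal θ₁ v x) - Real.log (gaussianPDFReal θ₀ v x) =
      (θ₁ - θ₀) / v * x + (θ₀ ^ 2 - θ₁ ^ 2) / (2 * v) := by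
  have hv' : (0 : ℝ) < v := by positivity
  have hc : (√(2 * Real.pi * v))⁻¹ ≠ 0 := by positivity
  rw [gaussianPDFReal, gaussianPDFReal, Real.log_mul hc (Real.exp_pos _).ne',
    Real.log_mul hc (Real.exp_pos _).ne', Real.log_exp, Real.log_exp]
  field_simp
  ring

/-- The log-likelihood ratio of two Gaussian laws is affine and not constant, hence unbounded. -/
lemma intrinsicBound_gaussian {f : ProbDensity} {v : ℝ≥0} (hv : v ≠ 0)
    (hf : ∀ x, f x = gaussianPDFReal 0 v x) {θ₀ θ₁ : ℝ} (hθ : θ₀ ≠ θ₁) :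
    intrinsicBound 0 (f.shift θ₀) (f.shift θ₁) = ⊤ := by
  have hv' : (0 : ℝ) < v := by positivity
  by_contra hne
  obtain ⟨t, ht, -⟩ := EReal.lt_iff_exists_real_btwn.1 (lt_top_iff_ne_top.2 hne)
  set U : Set ℝ := {x | t < (θ₁ - θ₀) / v * x + (θ₀ ^ 2 - θ₁ ^ 2) / (2 * v)} with hU
  have hUo : IsOpen U := isOpen_lt continuous_const (by fun_prop)
  have hUn : U.Nonempty := by
    refine ⟨(t + 1 - (θ₀ ^ 2 - θ₁ ^ 2) / (2 * v)) / ((θ₁ - θ₀) / v), ?_⟩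
    have hA : (θ₁ - θ₀) / v ≠ 0 := div_ne_zero (sub_ne_zero.2 hθ.symm) hv'.ne'
    show t < _
    rw [mul_div_cancel₀ _ hA]
    linarith
  refine (hUo.measure_pos volume hUn).ne' (measure_eq_zero_iff_ae_notMem.2 ?_)
  filter_upwards [ae_le_essSup (f := lAlphaRatio 0 (f.shift θ₀) (f.shift θ₁))] with x hx hxU
  have h1 := hx.trans ht.le
  have hp : ∀ θ, 0 < f.shift θ x := fun θ => by
    rw [shift_eq_gaussianPDFReal hf]; exact gaussianPDFReal_pos θ v x hv
  rw [lAlphaRatio_zero_of_pos (hp θ₀) (hp θ₁), EReal.coe_le_coe_iff,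
    shift_eq_gaussianPDFReal hf, shift_eq_gaussianPDFReal hf, log_gaussianPDFReal_sub hv] at h1
  exact absurd (show t < _ from hxU) (not_lt.2 h1)

lemma densityPowerDivergence_gaussian_ne_top {f : ProbDensity} {v : ℝ≥0} (hv : v ≠ 0)
    (hf : ∀ x, f x = gaussianPDFReal 0 v x) (θ₀ θ₁ : ℝ) :
    densityPowerDivergence 0 (f.shift θ₀) (f.shift θ₁) ≠ ⊤ := by
  have hp : ∀ θ x, 0 < f.shift θ x := fun θ x => by
    rw [shift_eq_gaussianPDFReal hf]; exact gaussianPDFReal_pos θ v x hv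
  have hac : (f.shift θ₀).law ≪ (f.shift θ₁).law :=
    (absolutelyContinuous_law_iff _ _).2 (Eventually.of_forall fun x hx =>
      absurd hx (hp θ₁ x).ne')
  rw [densityPowerDivergence, if_pos rfl]
  refine InformationTheory.klDiv_ne_top hac ?_
  have hint : Integrable (fun x : ℝ => (θ₀ - θ₁) / v * x + (θ₁ ^ 2 - θ₀ ^ 2) / (2 * v))
      (f.shift θ₀).law := by
    rw [law_shift_eq_gaussianReal hv hf]
    have h1 : Integrable id (gaussianReal θ₀ v) := (memLp_id_gaussianReal 1).integrable le_rfl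
    exact (h1.const_mul _).add (integrable_const _)
  refine hint.congr ?_
  filter_upwards [hac.ae_eq (rnDeriv_law hac)] with x hx
  rw [llr, hx, ENNReal.toReal_ofReal (div_pos (hp θ₀ x) (hp θ₁ x)).le,
    Real.log_div (hp θ₀ x).ne' (hp θ₁ x).ne', shift_eq_gaussianPDFReal hf,
    shift_eq_gaussianPDFReal hf, log_gaussianPDFReal_sub hv]

end Gaussian

/-! ### The breakdown point -/

lemma falseAlarmBreakdownPoint_eq_zero {α : ℝ} {f₀ f₁ : ProbDensity} {K : ℕ} (hK : 1 ≤ K) (d : ℝ)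
    (hM : intrinsicBound α f₀ f₁ = ⊤) (b : ℝ → ℝ) :
    falseAlarmBreakdownPoint f₀ (softThresholdScheme α f₀ f₁ K d) b = 0 :=
  falseAlarmBreakdownPoint_eq zero_le_one (fun _ h0 h1 => absurd h1 (not_lt.2 h0))
    (fun _ _ h0 h1 => breaksDown_of_intrinsicBound_eq_top hK h0 h1.le hM b) le_rfl

lemma falseAlarmBreakdownPoint_eq_one {f : ProbDensity} {θ₀ θ₁ α m d : ℝ} {K : ℕ} (hθ : θ₀ ≠ θ₁)
    (hα : 0 ≤ α) (hK : 1 ≤ K) (hd : 0 ≤ d) (hm : 0 < m)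
    (hM : intrinsicBound α (f.shift θ₀) (f.shift θ₁) = m)
    (hD : densityPowerDivergence α (f.shift θ₀) (f.shift θ₁) = ⊤) {b : ℝ → ℝ}
    (hb : SatisfiesFalseAlarmConstraint (f.shift θ₀)
      (softThresholdScheme α (f.shift θ₀) (f.shift θ₁) K d) b) :
    falseAlarmBreakdownPoint (f.shift θ₀)
      (softThresholdScheme α (f.shift θ₀) (f.shift θ₁) K d) b = 1 := by
  have hY : ∀ᵐ x, lAlphaRatio α (f.shift θ₀) (f.shift θ₁) x ≤ m := hM ▸ ae_le_essSup
  have hgap := lintegral_incrementGap hθ hα hm.le hY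
  rw [hD, top_add, ENNReal.mul_eq_top] at hgap
  have hgap' : 0 < 1 + α ∧
      ∫⁻ x, incrementGap α (f.shift θ₀) (f.shift θ₁) m x ∂(f.shift θ₀).law = ⊤ := by
    simpa using hgap
  refine falseAlarmBreakdownPoint_eq le_rfl (fun ε hε0 hε1 => ?_)
    (fun ε _ h1 h2 => absurd h1 (not_lt.2 h2.le)) zero_le_one
  refine not_breaksDown_of_drift_neg hK hd hε0 hε1 hm.le hY ?_ hb
  rw [hgap'.2, ENNReal.mul_top (by simpa using hε1)]
  exact ENNReal.ofReal_lt_top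

lemma falseAlarmBreakdownPoint_eq_div {f : ProbDensity} {θ₀ θ₁ α m D d : ℝ} {K : ℕ}
    (hθ : θ₀ ≠ θ₁) (hα : 0 ≤ α) (hK : 1 ≤ K) (hd : 0 ≤ d) (hm : 0 < m)
    (hM : intrinsicBound α (f.shift θ₀) (f.shift θ₁) = m) (hD0 : 0 < D)
    (hD : densityPowerDivergence α (f.shift θ₀) (f.shift θ₁) = ENNReal.ofReal D) {b : ℝ → ℝ}
    (hb : SatisfiesFalseAlarmConstraint (f.shift θ₀)
      (softThresholdScheme α (f.shift θ₀) (f.shift θ₁) K d) b) :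
    falseAlarmBreakdownPoint (f.shift θ₀)
      (softThresholdScheme α (f.shift θ₀) (f.shift θ₁) K d) b = D / (D + (1 + α) * m) := by
  have hY : ∀ᵐ x, lAlphaRatio α (f.shift θ₀) (f.shift θ₁) x ≤ m := hM ▸ ae_le_essSup
  have hα1 : 0 < 1 + α := by linarith
  have hden : 0 < D + (1 + α) * m := by positivity
  set μ := (D + (1 + α) * m) / (1 + α) with hμ
  have hμ0 : 0 < μ := by positivity
  have hμ1 : (1 + α) * μ = D + (1 + α) * m := by rw [hμ]; field_simp
  have hgap : ∫⁻ x, incrementGap α (f.shift θ₀) (f.shift θ₁) m x ∂(f.shift θ₀).law =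
      ENNReal.ofReal μ := by
    have h1 := lintegral_incrementGap hθ hα hm.le hY
    rw [hD, ← ENNReal.ofReal_add hD0.le (by positivity), ← hμ1, ENNReal.ofReal_mul hα1.le] at h1
    exact (ENNReal.mul_right_inj (by simpa using hα1) ENNReal.ofReal_ne_top).1 h1
  set e := D / (D + (1 + α) * m) with he
  -- `e` is the level at which the worst-case drift `m - (1 - ε) * μ` vanishes
  have hcrit : (1 - e) * μ = m := by
    rw [he, hμ]; field_simp; ring
  have he0 : 0 ≤ e := by positivity
  have he1 : e ≤ 1 := by
    rw [he, div_le_one hden]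
    have : 0 < (1 + α) * m := by positivity
    linarith
  have hno : ∀ ε, 0 ≤ ε → ε < e → ENNReal.ofReal m < ENNReal.ofReal (1 - ε) *
      ∫⁻ x, incrementGap α (f.shift θ₀) (f.shift θ₁) m x ∂(f.shift θ₀).law := by
    intro ε hε0 hεe
    rw [hgap, ← ENNReal.ofReal_mul (by linarith), ENNReal.ofReal_lt_ofReal_iff_of_nonneg hm.le]
    have := mul_lt_mul_of_pos_right (show 1 - e < 1 - ε by linarith) hμ0
    linarith
  obtain ⟨l, hl, hL⟩ := exists_exp_moment_le_one le_rfl zero_lt_one hm.le hY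
    (hno 0 le_rfl (by positivity))
  obtain ⟨C, hC, hbC⟩ := exists_threshold_le_log hK hd hb hl
    (hL _ (self_mem_contaminationClass _ _))
  refine falseAlarmBreakdownPoint_eq he1 (fun ε hε0 hεe => ?_) (fun ε hε0 hεe hε1 => ?_) he0
  · exact not_breaksDown_of_drift_neg hK hd hε0 (by linarith) hm.le hY (hno ε hε0 hεe) hb
  · refine breaksDown_of_drift_pos hK hd (by linarith) hε1.le hm hM hμ0.le hgap ?_ hC hbC
    have := mul_lt_mul_of_pos_right (show 1 - ε < 1 - e by linarith) hμ0
    linarith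

theorem theorem3
    (f : ProbDensity) (hf : Continuous f) (θ₀ θ₁ : ℝ)
    (hpos : ∃ x, 0 < f.shift θ₀ x - f.shift θ₁ x)
    (hneg : ∃ x, f.shift θ₀ x - f.shift θ₁ x < 0)
    (α : ℝ) (hα : 0 ≤ α) (K : ℕ) (hK : 1 ≤ K) (d : ℝ) (hd : 0 ≤ d) :
    (∀ b : ℝ → ℝ,
      SatisfiesFalseAlarmConstraint (f.shift θ₀)
        (softThresholdScheme α (f.shift θ₀) (f.shift θ₁) K d) b →
      (densityPowerDivergence α (f.shift θ₀) (f.shift θ₁) ≠ ⊤ →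
        intrinsicBound α (f.shift θ₀) (f.shift θ₁) ≠ ⊤ →
        falseAlarmBreakdownPoint (f.shift θ₀)
            (softThresholdScheme α (f.shift θ₀) (f.shift θ₁) K d) b =
          (densityPowerDivergence α (f.shift θ₀) (f.shift θ₁)).toReal /
            ((densityPowerDivergence α (f.shift θ₀) (f.shift θ₁)).toReal +
              (1 + α) * (intrinsicBound α (f.shift θ₀) (f.shift θ₁)).toReal)) ∧
      (densityPowerDivergence α (f.shift θ₀) (f.shift θ₁) ≠ ⊤ →
        intrinsicBound α (f.shift θ₀) (f.shift θ₁) = ⊤ →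
        falseAlarmBreakdownPoint (f.shift θ₀)
            (softThresholdScheme α (f.shift θ₀) (f.shift θ₁) K d) b = 0) ∧
      (densityPowerDivergence α (f.shift θ₀) (f.shift θ₁) = ⊤ →
        intrinsicBound α (f.shift θ₀) (f.shift θ₁) ≠ ⊤ →
        falseAlarmBreakdownPoint (f.shift θ₀)
            (softThresholdScheme α (f.shift θ₀) (f.shift θ₁) K d) b = 1)) ∧
    (∀ v : ℝ≥0, v ≠ 0 → (∀ x, f x = ProbabilityTheory.gaussianPDFReal 0 v x) → α = 0 →
      intrinsicBound α (f.shift θ₀) (f.shift θ₁) = ⊤ ∧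
      densityPowerDivergence α (f.shift θ₀) (f.shift θ₁) ≠ ⊤ ∧
      ∀ b : ℝ → ℝ,
        SatisfiesFalseAlarmConstraint (f.shift θ₀)
          (softThresholdScheme α (f.shift θ₀) (f.shift θ₁) K d) b →
        falseAlarmBreakdownPoint (f.shift θ₀)
          (softThresholdScheme α (f.shift θ₀) (f.shift θ₁) K d) b = 0) := by

  obtain ⟨x₀, hx₀⟩ := hpos
  obtain ⟨x₁, hx₁⟩ := hneg
  have hθ : θ₀ ≠ θ₁ := by
    rintro rfl
    simp at hx₀
  have hc : ∀ θ, Continuous (f.shift θ) := fun θ => hf.comp (continuous_id.sub continuous_const)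
  have hM0 : 0 < intrinsicBound α (f.shift θ₀) (f.shift θ₁) :=
    intrinsicBound_pos (hc θ₀) (hc θ₁) hα (sub_neg.1 hx₁)
  have hD0 : densityPowerDivergence α (f.shift θ₀) (f.shift θ₁) ≠ 0 :=
    densityPowerDivergence_ne_zero (hc θ₀) (hc θ₁) hα (sub_pos.1 hx₀).ne'
  have hreal : intrinsicBound α (f.shift θ₀) (f.shift θ₁) ≠ ⊤ →
      intrinsicBound α (f.shift θ₀) (f.shift θ₁) =
        ((intrinsicBound α (f.shift θ₀) (f.shift θ₁)).toReal : EReal) ∧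
      0 < (intrinsicBound α (f.shift θ₀) (f.shift θ₁)).toReal := fun hM =>
    ⟨(EReal.coe_toReal hM (EReal.bot_lt_zero.trans hM0).ne').symm, EReal.toReal_pos hM0 hM⟩
  refine ⟨fun b hb => ⟨fun hD hM => ?_, fun _ hM => ?_, fun hD hM => ?_⟩, ?_⟩
  · exact falseAlarmBreakdownPoint_eq_div hθ hα hK hd (hreal hM).2 (hreal hM).1
      (ENNReal.toReal_pos hD0 hD) (ENNReal.ofReal_toReal hD).symm hb
  · exact falseAlarmBreakdownPoint_eq_zero hK d hM b
  · exact falseAlarmBreakdownPoint_eq_one hθ hα hK hd (hreal hM).2 (hreal hM).1 hD hb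
  · rintro v hv hfv rfl
    have hM := intrinsicBound_gaussian hv hfv hθ
    exact ⟨hM, densityPowerDivergence_gaussian_ne_top hv hfv θ₀ θ₁,
      fun b _ => falseAlarmBreakdownPoint_eq_zero hK d hM b⟩
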